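/- Let $d\in\mathbb N$, let $\mathcal M=M_d(\mathbb C)$, and for $A\in\mathcal M$ let $\|A\|_p=(\mathrm{Tr}\,|A|^p)^{1/p}$ with $|A|=(A^*A)^{1/2}$ for $0<p<\infty$, and let $\|A\|_\infty$ be the operator norm. Let $\bar S=\{z\in\mathbb C:0\le\mathrm{Re}\,z\le1\}$ and let $G:\bar S\to\mathcal M$ be bounded and continuous on $\bar S$ and analytic in the interior $\{0<\mathrm{Re}\,z<1\}$. Let $0<p_0<p_1\le\infty$, let $0<\theta<1$, and define $p_\theta$ by $\frac1{p_\theta}=\frac{1-\theta}{p_0}+\frac{\theta}{p_1}$. Then $$\log\|G(\theta)\|_{p_\theta}\le\int_{-\infty}^{\infty}\Big(\beta_{1-\theta}(t)\,\log\|G(it)\|_{p_0}^{1-\theta}+\beta_\theta(t)\,\log\|G(1+it)\|_{p_1}^{\theta}\Big)\,dt,$$ where $$\beta_\theta(t)=\frac{\sin(\pi\theta)}{2\theta\,(\cosh(\pi t)+\cos(\pi\theta))}.$$ Here $\log 0=-\infty$. The integrand is a measurable function of $t$ with values in $[-\infty,\infty)$ whose positive part is integrable, so that the integral is well defined in $[-\infty,\infty)$.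 -/

import Mathlib

open scoped ENNReal

noncomputable section

open scoped MatrixOrder ComplexOrder in
/-- The Schatten (quasi-)norm `‖A‖_p` of a complex matrix, for `0 < p ≤ ∞`: it is
`(Tr |A|^p)^(1/p)` with `|A| = (A* A)^(1/2)` if `p < ∞`, and the operator norm with respect to the
Euclidean norm on `ℂ^d` if `p = ∞`. -/
def schattenNorm {d : ℕ} (p : ℝ≥0∞) (A : Matrix (Fin d) (Fin d) ℂ) : ℝ :=
  if p = ∞ then ‖Matrix.toEuclideanCLM (n := Fin d) (𝕜 := ℂ) A‖
  else (Matrix.trace (CFC.abs A ^ p.toReal)).re ^ (1 / p.toReal)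

/-- The class `AF(X)`: bounded functions on the closed strip `0 ≤ Re z ≤ 1` with values in `X` that
are continuous on the closed strip and analytic in the open strip. (Values outside the closed strip
play no role.) -/
structure IsAF {X : Type*} [NormedAddCommGroup X] [NormedSpace ℂ X] (f : ℂ → X) : Prop where
  analytic : DifferentiableOn ℂ f {z : ℂ | 0 < z.re ∧ z.re < 1}
  continuous : ContinuousOn f {z : ℂ | 0 ≤ z.re ∧ z.re ≤ 1}
  bounded : ∃ C : ℝ, ∀ z : ℂ, 0 ≤ z.re → z.re ≤ 1 → ‖f z‖ ≤ C

/-- The interpolated exponent, `1 / p_θ = (1 - θ) / p₀ + θ / p₁`. -/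
def interpExponent (p₀ p₁ : ℝ≥0∞) (θ : ℝ) : ℝ≥0∞ :=
  (ENNReal.ofReal (1 - θ) / p₀ + ENNReal.ofReal θ / p₁)⁻¹

/-- The kernel `β_θ(t) = sin(πθ) / (2θ (cosh(πt) + cos(πθ)))`. -/
def hirschmanKernel (θ t : ℝ) : ℝ :=
  Real.sin (Real.pi * θ) / (2 * θ * (Real.cosh (Real.pi * t) + Real.cos (Real.pi * θ)))

/-- The logarithm of a nonnegative real number as an extended real, with `log 0 = -∞`. -/
def extLog (x : ℝ) : EReal := ENNReal.log (ENNReal.ofReal x)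

/-- The Lebesgue integral over `ℝ` of an extended-real-valued function,
`∫ f = ∫ f⁺ - ∫ f⁻`; it is meaningful for measurable `f` such that `∫ f⁺` or `∫ f⁻` is finite. -/
def extIntegral (f : ℝ → EReal) : EReal :=
  ((∫⁻ t, (f t).toENNReal : ℝ≥0∞) : EReal) - ((∫⁻ t, (-f t).toENNReal : ℝ≥0∞) : EReal)

/-- The integrand
`β_{1-θ}(t) log ‖G(it)‖_{p₀}^{1-θ} + β_θ(t) log ‖G(1+it)‖_{p₁}^θ`. -/
def hirschmanIntegrand {d : ℕ} (G : ℂ → Matrix (Fin d) (Fin d) ℂ) (p₀ p₁ : ℝ≥0∞) (θ t : ℝ) :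
    EReal :=
  (hirschmanKernel (1 - θ) t : EReal) *
      extLog (schattenNorm p₀ (G (Complex.I * t)) ^ (1 - θ)) +
    (hirschmanKernel θ t : EReal) *
      extLog (schattenNorm p₁ (G (1 + Complex.I * t)) ^ θ)

end

open scoped Matrix.Norms.L2Operator

/-!
The difficulty is that `‖·‖_p` is not a norm for `p < 1`, so that duality is not available. The
proof replaces it by a variational formula for `log ‖A‖_p` that holds for all `0 < p ≤ ∞` and whose terms
are logarithms of moduli of holomorphic functions of `A`.

Let `s₀ ≥ s₁ ≥ …` be the singular values. For a probability vector `w` with entropy `h`, Gibbs'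
variational principle gives `∑ wᵢ log sᵢ(B) + h / q ≤ log ‖B‖_q` for every `q`, with equality if
`B = A`, `q = p` and `wᵢ` is proportional to `sᵢ(A) ^ p`. These weights decrease, so by summation by
parts `∑ wᵢ log sᵢ(B) = ∑ cₖ log (s₀(B) ⋯ sₖ(B))` with `cₖ = wₖ - wₖ₊₁ ≥ 0`. Finally
`s₀(B) ⋯ sₖ(B)` is at least the modulus of the `(k + 1) × (k + 1)` minor of `B` with respect to the
leading singular vectors of `A`, with equality for `B = A`; this follows from the Cauchy–Binet
formula. The minor is a polynomial in the entries of `B`. All this is collected in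
`exists_log_schattenNorm_eq`.

For `A = G θ` and `p = p_θ`, the scalar functions obtained by composing these minors with `G` are
bounded and analytic in the strip, so Hirschman's lemma `log_norm_le_integral_strip` bounds their
logarithms at `θ` by integrals over the boundary against harmonic measure. On the boundary the
variational inequality is applied with `q = p₀` and with `q = p₁`. The two boundary lines have
harmonic measure `1 - θ` and `θ`, so that the entropy terms add up to
`h ((1 - θ) / p₀ + θ / p₁) = h / p_θ` and cancel.

Hirschman's lemma is obtained by mapping the unit disc conformally onto the strip, `0` to `θ`:
Jensen's formula bounds `log |F 0|` by the mean of `log |F|` over circles of radius `r < 1`, Fatou's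
lemma passes to `r = 1`, and a change of variables turns the circle into the two boundary lines.
-/

open MeasureTheory Filter Topology Set

/-! ### Jensen's inequality on the unit disc -/

/-- The positive part of `-log x`, as an extended nonnegative real, with the value `∞` at `0`. -/
noncomputable def negLog (x : ℝ) : ℝ≥0∞ := (-extLog x).toENNReal

lemma extLog_of_pos {x : ℝ} (hx : 0 < x) : extLog x = (Real.log x : EReal) := by
  rw [extLog, ENNReal.log_ofReal_of_pos hx]

lemma continuous_extLog : Continuous extLog :=
  ENNReal.continuous_log.comp ENNReal.continuous_ofReal

lemma continuous_negLog : Continuous negLog :=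
  EReal.continuous_toENNReal.comp (continuous_neg.comp continuous_extLog)

lemma negLog_of_pos {x : ℝ} (hx : 0 < x) : negLog x = ENNReal.ofReal (-Real.log x) := by
  rw [negLog, extLog_of_pos hx, ← EReal.coe_neg]; rfl

lemma negLog_zero : negLog 0 = ∞ := by
  simp [negLog, extLog]

/-- Jensen's inequality: in Jensen's formula the zeros of `F` contribute nonnegative terms. -/
lemma log_norm_le_circleAverage {F : ℂ → ℂ} {r : ℝ} (hr : 0 < r)
    (hF : AnalyticOnNhd ℂ F (Metric.closedBall 0 r)) (h0 : F 0 ≠ 0) :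
    Real.log ‖F 0‖ ≤ Real.circleAverage (fun z => Real.log ‖F z‖) 0 r := by
  rw [AnalyticOnNhd.circleAverage_log_norm hr.ne' (by rwa [abs_of_pos hr]) h0]
  refine le_add_of_nonneg_left (finsum_nonneg fun u => ?_)
  by_cases hu : u ∈ Metric.closedBall (0 : ℂ) |r|
  · refine mul_nonneg ?_ ?_
    · exact_mod_cast MeromorphicOn.AnalyticOnNhd.divisor_nonneg (by rwa [abs_of_pos hr]) u
    · rcases eq_or_ne u 0 with rfl | hu0
      · simp
      · refine Real.log_nonneg ?_
        have h1 : ‖u‖ ≤ r := by simpa [abs_of_pos hr] using hu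
        have h2 : 0 < ‖u‖ := norm_pos_iff.2 hu0
        rw [zero_sub, norm_neg, ← div_eq_mul_inv, one_le_div h2]
        exact h1
  · rw [Function.locallyFinsuppWithin.apply_eq_zero_of_notMem _ hu]
    simp

lemma lintegral_negLog_circle_le {F : ℂ → ℂ} {r : ℝ} (hr : 0 < r)
    (hF : AnalyticOnNhd ℂ F (Metric.closedBall 0 r)) (h0 : F 0 ≠ 0)
    (hb : ∀ z ∈ Metric.closedBall (0 : ℂ) r, ‖F z‖ ≤ 1) :
    ∫⁻ α in Ioc 0 (2 * Real.pi), negLog ‖F (circleMap 0 r α)‖ ≤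
      ENNReal.ofReal (2 * Real.pi * -Real.log ‖F 0‖) := by
  have hmem : ∀ α, circleMap 0 r α ∈ Metric.closedBall (0 : ℂ) r := fun α =>
    circleMap_mem_closedBall 0 hr.le α
  have hint : CircleIntegrable (fun z => Real.log ‖F z‖) 0 r :=
    MeromorphicOn.circleIntegrable_log_norm
      fun z hz => (hF z (Metric.sphere_subset_closedBall
        (by rwa [abs_of_pos hr] at hz))).meromorphicAt
  have hint' : IntegrableOn (fun α => Real.log ‖F (circleMap 0 r α)‖) (Ioc 0 (2 * Real.pi)) :=
    (intervalIntegrable_iff_integrableOn_Ioc_of_le (by positivity)).1 hint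
  have hpos : ∀ α, 0 ≤ -Real.log ‖F (circleMap 0 r α)‖ := fun α =>
    neg_nonneg.2 (Real.log_nonpos (norm_nonneg _) (hb _ (hmem α)))
  have hne : ∀ᵐ α ∂volume.restrict (Ioc 0 (2 * Real.pi)), F (circleMap 0 r α) ≠ 0 := by
    have h1 : F ⁻¹' {0}ᶜ ∈ codiscreteWithin (Metric.closedBall (0 : ℂ) r) :=
      hF.preimage_zero_mem_codiscreteWithin h0 (Metric.mem_closedBall_self hr.le)
        (Metric.isConnected_closedBall hr.le)
    have h2 : F ⁻¹' {0}ᶜ ∈ codiscreteWithin (Metric.sphere (0 : ℂ) |r|) :=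
      codiscreteWithin_mono (by rw [abs_of_pos hr]; exact Metric.sphere_subset_closedBall) h1
    exact ae_restrict_le_codiscreteWithin measurableSet_Ioc
      (codiscreteWithin_mono (subset_univ _) (circleMap_preimage_codiscrete hr.ne' h2))
  have hjensen := log_norm_le_circleAverage hr hF h0
  rw [Real.circleAverage_def, smul_eq_mul,
    intervalIntegral.integral_of_le (by positivity : (0 : ℝ) ≤ 2 * Real.pi)] at hjensen
  calc ∫⁻ α in Ioc 0 (2 * Real.pi), negLog ‖F (circleMap 0 r α)‖
      = ∫⁻ α in Ioc 0 (2 * Real.pi), ENNReal.ofReal (-Real.log ‖F (circleMap 0 r α)‖) := by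
        refine lintegral_congr_ae (hne.mono fun α hα => ?_)
        exact negLog_of_pos (norm_pos_iff.2 hα)
    _ = ENNReal.ofReal (∫ α in Ioc 0 (2 * Real.pi), -Real.log ‖F (circleMap 0 r α)‖) :=
        (ofReal_integral_eq_lintegral_ofReal hint'.neg (.of_forall hpos)).symm
    _ ≤ _ := by
        refine ENNReal.ofReal_le_ofReal ?_
        rw [integral_neg, mul_neg, neg_le_neg_iff]
        rwa [inv_mul_eq_div, le_div_iff₀' (by positivity)] at hjensen

/-- Jensen's inequality on the unit circle, in terms of radial limits, which need only exist on a
part `S` of the circle. Since `negLog` is nonnegative, Fatou's lemma applies as `r → 1`. -/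
lemma lintegral_negLog_boundary_le {F : ℂ → ℂ} (hF : DifferentiableOn ℂ F (Metric.ball 0 1))
    (h0 : F 0 ≠ 0) (hb : ∀ z ∈ Metric.ball (0 : ℂ) 1, ‖F z‖ ≤ 1) {S : Set ℝ}
    (hS : MeasurableSet S) (hS' : S ⊆ Ioc 0 (2 * Real.pi)) {b : ℝ → ℝ}
    (hlim : ∀ α ∈ S, Tendsto (fun r : ℝ => ‖F (circleMap 0 r α)‖) (𝓝[<] 1) (𝓝 (b α))) :
    ∫⁻ α in S, negLog (b α) ≤ ENNReal.ofReal (2 * Real.pi * -Real.log ‖F 0‖) := by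
  obtain ⟨r, -, hr1, hrlim⟩ := exists_seq_strictMono_tendsto' (show (0 : ℝ) < 1 by norm_num)
  have hrlim' : Tendsto r atTop (𝓝[<] 1) :=
    tendsto_nhdsWithin_iff.2 ⟨hrlim, .of_forall fun n => (hr1 n).2⟩
  have hsub : ∀ n, Metric.closedBall (0 : ℂ) (r n) ⊆ Metric.ball 0 1 := fun n =>
    Metric.closedBall_subset_ball (hr1 n).2
  have hmeas : ∀ n, Measurable fun α => negLog ‖F (circleMap 0 (r n) α)‖ := fun n => by
    have : Continuous fun α => F (circleMap 0 (r n) α) :=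
      hF.continuousOn.comp_continuous (continuous_circleMap 0 (r n)) fun α =>
        hsub n (circleMap_mem_closedBall 0 (hr1 n).1.le α)
    exact (continuous_negLog.comp this.norm).measurable
  calc ∫⁻ α in S, negLog (b α)
      = ∫⁻ α in S, liminf (fun n => negLog ‖F (circleMap 0 (r n) α)‖) atTop := by
        refine setLIntegral_congr_fun hS fun α hα => ?_
        exact ((continuous_negLog.tendsto _).comp ((hlim α hα).comp hrlim')).liminf_eq.symm
    _ ≤ ∫⁻ α in Ioc 0 (2 * Real.pi), liminf (fun n => negLog ‖F (circleMap 0 (r n) α)‖) atTop :=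
        lintegral_mono_set hS'
    _ ≤ liminf (fun n => ∫⁻ α in Ioc 0 (2 * Real.pi), negLog ‖F (circleMap 0 (r n) α)‖) atTop :=
        lintegral_liminf_le hmeas
    _ ≤ _ := by
        refine liminf_le_of_frequently_le' (.of_forall fun n => ?_)
        exact lintegral_negLog_circle_le (hr1 n).1
          ((hF.analyticOnNhd Metric.isOpen_ball).mono (hsub n)) h0 fun z hz => hb z (hsub n hz)

/-! ### Harmonic measure of the strip -/

/-- The density at height `t` of the harmonic measure of the strip `0 ≤ Re z ≤ 1`, seen from `θ`, on
the line `Re z = 0` for `ε = 1`, and on the line `Re z = 1` for `ε = -1`. -/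
noncomputable def stripDensity (θ ε t : ℝ) : ℝ :=
  Real.sin (Real.pi * θ) / (2 * (Real.cosh (Real.pi * t) - ε * Real.cos (Real.pi * θ)))

/-- The conformal map of the unit disc onto the strip `0 < Re z < 1` that sends `0` to `θ`. The
Cayley transform followed by a real affine map takes the disc to the upper half-plane and `0` to
`exp (iπθ)`, and `w ↦ log w / (iπ)` takes the upper half-plane to the strip. -/
noncomputable def discToStrip (θ : ℝ) (ζ : ℂ) : ℂ :=
  Complex.log (Real.cos (Real.pi * θ) + Real.sin (Real.pi * θ) * (Complex.I * (1 + ζ) / (1 - ζ))) /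
    (Complex.I * Real.pi)

/-- The angle of the point of the unit circle that `discToStrip θ` sends to `it` for `ε = 1`, and to
`1 + it` for `ε = -1`. -/
noncomputable def stripAngle (θ ε t : ℝ) : ℝ :=
  Real.pi + 2 * Real.arctan
    ((ε * Real.exp (-(Real.pi * t)) - Real.cos (Real.pi * θ)) / Real.sin (Real.pi * θ))

section

variable {θ : ℝ}

lemma sin_pi_mul_pos (hθ₀ : 0 < θ) (hθ₁ : θ < 1) : 0 < Real.sin (Real.pi * θ) :=
  Real.sin_pos_of_pos_of_lt_pi (by positivity) (by nlinarith [Real.pi_pos])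

lemma cosh_sub_mul_cos_pos (hθ₀ : 0 < θ) (hθ₁ : θ < 1) {ε : ℝ} (hε : ε ^ 2 = 1) (t : ℝ) :
    0 < Real.cosh (Real.pi * t) - ε * Real.cos (Real.pi * θ) := by
  have h1 := Real.one_le_cosh (Real.pi * t)
  have h2 := sin_pi_mul_pos hθ₀ hθ₁
  have h3 : (ε * Real.cos (Real.pi * θ)) ^ 2 < 1 := by
    rw [mul_pow, hε, one_mul]; nlinarith [Real.sin_sq_add_cos_sq (Real.pi * θ)]
  have h4 := (abs_lt.1 ((sq_lt_one_iff_abs_lt_one _).1 h3)).2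
  linarith

lemma stripDensity_pos (hθ₀ : 0 < θ) (hθ₁ : θ < 1) {ε : ℝ} (hε : ε ^ 2 = 1) (t : ℝ) :
    0 < stripDensity θ ε t :=
  div_pos (sin_pi_mul_pos hθ₀ hθ₁) (mul_pos two_pos (cosh_sub_mul_cos_pos hθ₀ hθ₁ hε t))

lemma continuous_stripDensity (hθ₀ : 0 < θ) (hθ₁ : θ < 1) {ε : ℝ} (hε : ε ^ 2 = 1) :
    Continuous (stripDensity θ ε) := by
  unfold stripDensity
  refine continuous_const.div (by fun_prop) fun t => ?_
  exact (mul_pos two_pos (cosh_sub_mul_cos_pos hθ₀ hθ₁ hε t)).ne'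

lemma hirschmanKernel_mul (hθ₀ : 0 < θ) (t : ℝ) :
    θ * hirschmanKernel θ t = stripDensity θ (-1) t := by
  rw [hirschmanKernel, stripDensity, neg_one_mul, sub_neg_eq_add, mul_div_assoc',
    mul_comm 2 θ, mul_assoc, mul_div_mul_left _ _ hθ₀.ne']

lemma hirschmanKernel_one_sub_mul (hθ₁ : θ < 1) (t : ℝ) :
    (1 - θ) * hirschmanKernel (1 - θ) t = stripDensity θ 1 t := by
  have h : Real.pi * (1 - θ) = Real.pi - Real.pi * θ := by ring
  rw [hirschmanKernel_mul (sub_pos.2 hθ₁), stripDensity, stripDensity, h, Real.sin_pi_sub,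
    Real.cos_pi_sub]
  congr 3
  ring

/-- The parametrisation of the circle by a boundary line of the strip transports arc length to
`2π` times harmonic measure. -/
lemma hasDerivAt_stripAngle (hθ₀ : 0 < θ) (hθ₁ : θ < 1) {ε : ℝ} (hε : ε ^ 2 = 1) (t : ℝ) :
    HasDerivAt (stripAngle θ ε) (-ε * (2 * Real.pi * stripDensity θ ε t)) t := by
  have hs := sin_pi_mul_pos hθ₀ hθ₁
  have hc := cosh_sub_mul_cos_pos hθ₀ hθ₁ hε t
  have h1 : HasDerivAt (fun t => (ε * Real.exp (-(Real.pi * t)) - Real.cos (Real.pi * θ)) /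
      Real.sin (Real.pi * θ)) (ε * (Real.exp (-(Real.pi * t)) * -(Real.pi * 1)) /
        Real.sin (Real.pi * θ)) t :=
    ((((((hasDerivAt_id t).const_mul Real.pi).neg).exp).const_mul ε).sub_const _).div_const _
  have h2 := (h1.arctan.const_mul 2).const_add Real.pi
  refine h2.congr_deriv ?_
  have hE := Real.exp_pos (-(Real.pi * t))
  have hsc := Real.sin_sq_add_cos_sq (Real.pi * θ)
  have hcosh : Real.cosh (Real.pi * t) =
      (Real.exp (-(Real.pi * t)) + (Real.exp (-(Real.pi * t)))⁻¹) / 2 := by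
    rw [Real.cosh_eq, Real.exp_neg, inv_inv]; ring
  rw [stripDensity]
  rw [hcosh] at hc ⊢
  generalize Real.exp (-(Real.pi * t)) = E at *
  generalize Real.sin (Real.pi * θ) = s at *
  generalize Real.cos (Real.pi * θ) = c at *
  have h3 : 0 < E ^ 2 + 1 - 2 * ε * c * E := by
    have : E ^ 2 + 1 - 2 * ε * c * E = 2 * E * ((E + E⁻¹) / 2 - ε * c) := by field_simp
    rw [this]; positivity
  have h4 : 1 + ((ε * E - c) / s) ^ 2 = (E ^ 2 + 1 - 2 * ε * c * E) / s ^ 2 := by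
    field_simp
    linear_combination hsc + E ^ 2 * hε
  have h5 : 2 * ((E + E⁻¹) / 2 - ε * c) = (E ^ 2 + 1 - 2 * ε * c * E) / E := by
    field_simp
  rw [h4, h5]
  field_simp

lemma stripAngle_mem (ε t : ℝ) : stripAngle θ ε t ∈ Ioc 0 (2 * Real.pi) := by
  have h1 := Real.neg_pi_div_two_lt_arctan
    ((ε * Real.exp (-(Real.pi * t)) - Real.cos (Real.pi * θ)) / Real.sin (Real.pi * θ))
  have h2 := Real.arctan_lt_pi_div_two
    ((ε * Real.exp (-(Real.pi * t)) - Real.cos (Real.pi * θ)) / Real.sin (Real.pi * θ))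
  constructor <;> simp only [stripAngle] <;> linarith

lemma stripAngle_eq_iff (hθ₀ : 0 < θ) (hθ₁ : θ < 1) {ε ε' t t' : ℝ} :
    stripAngle θ ε t = stripAngle θ ε' t' ↔
      ε * Real.exp (-(Real.pi * t)) = ε' * Real.exp (-(Real.pi * t')) := by
  have hs := sin_pi_mul_pos hθ₀ hθ₁
  simp only [stripAngle, add_right_inj, mul_eq_mul_left_iff, OfNat.ofNat_ne_zero, or_false,
    Real.arctan_injective.eq_iff, div_left_inj' hs.ne', sub_left_inj]

lemma injective_stripAngle (hθ₀ : 0 < θ) (hθ₁ : θ < 1) {ε : ℝ} (hε : ε ^ 2 = 1) :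
    Function.Injective (stripAngle θ ε) := fun t t' h => by
  have h0 : ε ≠ 0 := by rintro rfl; norm_num at hε
  have := mul_left_cancel₀ h0 ((stripAngle_eq_iff hθ₀ hθ₁).1 h)
  have := Real.exp_injective this
  exact mul_left_cancel₀ Real.pi_ne_zero (neg_injective this)

lemma disjoint_range_stripAngle (hθ₀ : 0 < θ) (hθ₁ : θ < 1) :
    Disjoint (range (stripAngle θ 1)) (range (stripAngle θ (-1))) := by
  rw [Set.disjoint_iff_forall_ne]
  rintro _ ⟨t, rfl⟩ _ ⟨t', rfl⟩ h
  have := (stripAngle_eq_iff hθ₀ hθ₁).1 h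
  nlinarith [Real.exp_pos (-(Real.pi * t)), Real.exp_pos (-(Real.pi * t'))]

lemma measurableSet_range_stripAngle (hθ₀ : 0 < θ) (hθ₁ : θ < 1) {ε : ℝ} (hε : ε ^ 2 = 1) :
    MeasurableSet (range (stripAngle θ ε)) := by
  have hc : Continuous (stripAngle θ ε) :=
    continuous_iff_continuousAt.2 fun t => (hasDerivAt_stripAngle hθ₀ hθ₁ hε t).continuousAt
  exact (hc.measurableEmbedding (injective_stripAngle hθ₀ hθ₁ hε)).measurableSet_range

lemma lintegral_range_stripAngle (hθ₀ : 0 < θ) (hθ₁ : θ < 1) {ε : ℝ} (hε : ε ^ 2 = 1)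
    (u : ℝ → ℝ≥0∞) :
    ∫⁻ α in range (stripAngle θ ε), u α =
      ∫⁻ t, ENNReal.ofReal (2 * Real.pi * stripDensity θ ε t) * u (stripAngle θ ε t) := by
  rw [← image_univ, lintegral_image_eq_lintegral_abs_deriv_mul MeasurableSet.univ
    (fun t _ => (hasDerivAt_stripAngle hθ₀ hθ₁ hε t).hasDerivWithinAt)
    (injective_stripAngle hθ₀ hθ₁ hε).injOn, Measure.restrict_univ]
  have h : |ε| = 1 := by rwa [← sq_eq_sq₀ (abs_nonneg _) zero_le_one, sq_abs, one_pow]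
  have hk := stripDensity_pos hθ₀ hθ₁ hε
  refine lintegral_congr fun t => ?_
  rw [abs_mul, abs_neg, h, one_mul, abs_of_pos (mul_pos (by positivity) (hk t))]

lemma integrable_stripDensity (hθ₀ : 0 < θ) (hθ₁ : θ < 1) {ε : ℝ} (hε : ε ^ 2 = 1) :
    Integrable (stripDensity θ ε) := by
  have h1 : ∫⁻ t, ENNReal.ofReal (2 * Real.pi * stripDensity θ ε t) < ∞ := by
    have := lintegral_range_stripAngle hθ₀ hθ₁ hε fun _ => 1
    simp only [mul_one] at this
    rw [← this, setLIntegral_one]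
    refine (measure_mono (t := Ioc 0 (2 * Real.pi)) ?_).trans_lt measure_Ioc_lt_top
    rintro _ ⟨t, rfl⟩
    exact stripAngle_mem ε t
  have h2 : Integrable fun t => 2 * Real.pi * stripDensity θ ε t := by
    refine ⟨((continuous_stripDensity hθ₀ hθ₁ hε).const_smul
      (2 * Real.pi)).aestronglyMeasurable, ?_⟩
    rwa [hasFiniteIntegral_iff_ofReal (.of_forall fun t =>
      (mul_pos (by positivity) (stripDensity_pos hθ₀ hθ₁ hε t)).le)]
  refine (h2.const_mul (2 * Real.pi)⁻¹).congr (.of_forall fun t => ?_)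
  exact inv_mul_cancel_left₀ (by positivity) _

lemma arctan_cot (hθ₀ : 0 < θ) (hθ₁ : θ < 1) :
    Real.arctan (-Real.cos (Real.pi * θ) / Real.sin (Real.pi * θ)) =
      Real.pi * θ - Real.pi / 2 := by
  rw [show -Real.cos (Real.pi * θ) / Real.sin (Real.pi * θ) =
    Real.tan (Real.pi * θ - Real.pi / 2) by
      rw [Real.tan_eq_sin_div_cos, Real.sin_sub_pi_div_two, Real.cos_sub_pi_div_two]]
  exact Real.arctan_tan (by nlinarith [Real.pi_pos]) (by nlinarith [Real.pi_pos])

lemma tendsto_stripAngle_atTop (hθ₀ : 0 < θ) (hθ₁ : θ < 1) (ε : ℝ) :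
    Tendsto (stripAngle θ ε) atTop (𝓝 (2 * Real.pi * θ)) := by
  have h1 : Tendsto (fun t : ℝ => Real.exp (-(Real.pi * t))) atTop (𝓝 0) :=
    Real.tendsto_exp_neg_atTop_nhds_zero.comp (tendsto_id.const_mul_atTop Real.pi_pos)
  have h2 := ((Real.continuous_arctan.tendsto _).comp
    (((h1.const_mul ε).sub_const (Real.cos (Real.pi * θ))).div_const
      (Real.sin (Real.pi * θ)))).const_mul 2 |>.const_add Real.pi
  rw [mul_zero, zero_sub, arctan_cot hθ₀ hθ₁] at h2
  rwa [show Real.pi + 2 * (Real.pi * θ - Real.pi / 2) = 2 * Real.pi * θ by ring] at h2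

lemma tendsto_stripAngle_one_atBot (hθ₀ : 0 < θ) (hθ₁ : θ < 1) :
    Tendsto (stripAngle θ 1) atBot (𝓝 (2 * Real.pi)) := by
  have h1 : Tendsto (fun t : ℝ => Real.exp (-(Real.pi * t))) atBot atTop :=
    Real.tendsto_exp_atTop.comp
      (tendsto_neg_atBot_atTop.comp (tendsto_id.const_mul_atBot Real.pi_pos))
  have h2 : Tendsto (fun t : ℝ => (1 * Real.exp (-(Real.pi * t)) - Real.cos (Real.pi * θ)) /
      Real.sin (Real.pi * θ)) atBot atTop := by
    simp only [one_mul, sub_eq_add_neg]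
    exact (tendsto_atTop_add_const_right _ _ h1).atTop_div_const (sin_pi_mul_pos hθ₀ hθ₁)
  have h3 := ((Real.tendsto_arctan_atTop.mono_right nhdsWithin_le_nhds).comp h2).const_mul 2
    |>.const_add Real.pi
  rwa [show Real.pi + 2 * (Real.pi / 2) = 2 * Real.pi by ring] at h3

lemma tendsto_stripAngle_neg_one_atBot (hθ₀ : 0 < θ) (hθ₁ : θ < 1) :
    Tendsto (stripAngle θ (-1)) atBot (𝓝 0) := by
  have h1 : Tendsto (fun t : ℝ => Real.exp (-(Real.pi * t))) atBot atTop :=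
    Real.tendsto_exp_atTop.comp
      (tendsto_neg_atBot_atTop.comp (tendsto_id.const_mul_atBot Real.pi_pos))
  have h2 : Tendsto (fun t : ℝ => (-1 * Real.exp (-(Real.pi * t)) - Real.cos (Real.pi * θ)) /
      Real.sin (Real.pi * θ)) atBot atBot := by
    simp only [neg_one_mul, sub_eq_add_neg]
    exact (tendsto_atBot_add_const_right _ _ (tendsto_neg_atTop_atBot.comp h1)).atBot_div_const
      (sin_pi_mul_pos hθ₀ hθ₁)
  have h3 := ((Real.tendsto_arctan_atBot.mono_right nhdsWithin_le_nhds).comp h2).const_mul 2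
    |>.const_add Real.pi
  rwa [show Real.pi + 2 * -(Real.pi / 2) = 0 by ring] at h3

lemma integral_stripDensity_one (hθ₀ : 0 < θ) (hθ₁ : θ < 1) :
    ∫ t, stripDensity θ 1 t = 1 - θ := by
  have h := integral_of_hasDerivAt_of_tendsto
    (fun t => hasDerivAt_stripAngle hθ₀ hθ₁ (one_pow 2) t)
    (((integrable_stripDensity hθ₀ hθ₁ (one_pow 2)).const_mul _).const_mul _)
    (tendsto_stripAngle_one_atBot hθ₀ hθ₁) (tendsto_stripAngle_atTop hθ₀ hθ₁ 1)
  rw [integral_const_mul, integral_const_mul] at h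
  have hpi := Real.pi_pos
  apply mul_left_cancel₀ (show 2 * Real.pi ≠ 0 by positivity)
  linear_combination -h

lemma integral_stripDensity_neg_one (hθ₀ : 0 < θ) (hθ₁ : θ < 1) :
    ∫ t, stripDensity θ (-1) t = θ := by
  have h := integral_of_hasDerivAt_of_tendsto
    (fun t => hasDerivAt_stripAngle hθ₀ hθ₁ (show (-1 : ℝ) ^ 2 = 1 by norm_num) t)
    (((integrable_stripDensity hθ₀ hθ₁ (by norm_num)).const_mul _).const_mul _)
    (tendsto_stripAngle_neg_one_atBot hθ₀ hθ₁) (tendsto_stripAngle_atTop hθ₀ hθ₁ (-1))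
  rw [integral_const_mul, integral_const_mul] at h
  have hpi := Real.pi_pos
  apply mul_left_cancel₀ (show 2 * Real.pi ≠ 0 by positivity)
  linear_combination h

end

/-! ### Hirschman's lemma for scalar functions -/

lemma circleMap_pi_add_two_mul_arctan (r x : ℝ) :
    circleMap 0 r (Real.pi + 2 * Real.arctan x) =
      r * ((x - Complex.I) / (x + Complex.I)) := by
  have hx : (0 : ℝ) < √(1 + x ^ 2) := by positivity
  have h1 : Complex.exp (Real.arctan x * Complex.I) = (1 + x * Complex.I) / √(1 + x ^ 2) := by
    rw [Complex.exp_mul_I, ← Complex.ofReal_cos, ← Complex.ofReal_sin, Real.cos_arctan,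
      Real.sin_arctan]
    push_cast
    ring
  have h2 : ((√(1 + x ^ 2) : ℝ) : ℂ) ^ 2 = (x + Complex.I) * (x - Complex.I) := by
    rw [← Complex.ofReal_pow, Real.sq_sqrt (by positivity)]
    push_cast
    linear_combination Complex.I_sq
  have h3 : (x + Complex.I : ℂ) ≠ 0 := fun h => by simpa using congrArg Complex.im h
  have h4 : (x - Complex.I : ℂ) ≠ 0 := fun h => by simpa using congrArg Complex.im h
  rw [circleMap_zero, show ((Real.pi + 2 * Real.arctan x : ℝ) : ℂ) * Complex.I =
    Real.pi * Complex.I + (Real.arctan x * Complex.I + Real.arctan x * Complex.I) by push_cast; ring,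
    Complex.exp_add, Complex.exp_add, Complex.exp_pi_mul_I, h1, div_mul_div_comm, ← sq, ← sq, h2]
  field_simp
  linear_combination (-(r : ℂ) * (1 + x ^ 2)) * Complex.I_sq

lemma cayley_im_pos {ζ : ℂ} (hζ : ‖ζ‖ < 1) : 0 < (Complex.I * (1 + ζ) / (1 - ζ)).im := by
  have h1 : (1 - ζ) ≠ 0 := fun h => by
    rw [← sub_eq_zero.1 h] at hζ; simp at hζ
  have h2 : ζ.re ^ 2 + ζ.im ^ 2 < 1 := by
    have : ‖ζ‖ ^ 2 < 1 := by nlinarith [norm_nonneg ζ]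
    rwa [← Complex.normSq_eq_norm_sq, Complex.normSq_apply, ← sq, ← sq] at this
  have h3 := Complex.normSq_pos.2 h1
  rw [Complex.div_im, ← sub_div]
  refine div_pos ?_ h3
  simp
  nlinarith

section

variable {θ : ℝ}

lemma affine_cayley_im_pos (hθ₀ : 0 < θ) (hθ₁ : θ < 1) {ζ : ℂ} (hζ : ‖ζ‖ < 1) :
    0 < (Real.cos (Real.pi * θ) + Real.sin (Real.pi * θ) *
      (Complex.I * (1 + ζ) / (1 - ζ)) : ℂ).im := by
  rw [Complex.add_im, Complex.ofReal_im, zero_add, Complex.im_ofReal_mul]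
  exact mul_pos (sin_pi_mul_pos hθ₀ hθ₁) (cayley_im_pos hζ)

lemma discToStrip_mem (hθ₀ : 0 < θ) (hθ₁ : θ < 1) {ζ : ℂ} (hζ : ‖ζ‖ < 1) :
    0 < (discToStrip θ ζ).re ∧ (discToStrip θ ζ).re < 1 := by
  have hw := affine_cayley_im_pos hθ₀ hθ₁ hζ
  rw [discToStrip]
  generalize (Real.cos (Real.pi * θ) + Real.sin (Real.pi * θ) *
      (Complex.I * (1 + ζ) / (1 - ζ)) : ℂ) = w at hw ⊢
  have hre : (Complex.log w / (Complex.I * Real.pi)).re = w.arg / Real.pi := by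
    rw [← div_div, Complex.div_ofReal_re, Complex.div_I]
    simp [Complex.log_im]
  have h1 : 0 < w.arg := by
    refine lt_of_le_of_ne (Complex.arg_nonneg_iff.2 hw.le) fun h => ?_
    exact hw.ne' (Complex.arg_eq_zero_iff.1 h.symm).2
  have h2 : w.arg < Real.pi := by
    refine lt_of_le_of_ne (Complex.arg_le_pi w) fun h => ?_
    exact hw.ne' (Complex.arg_eq_pi_iff.1 h).2
  rw [hre]
  exact ⟨div_pos h1 Real.pi_pos, (div_lt_one Real.pi_pos).2 h2⟩

lemma differentiableOn_discToStrip (hθ₀ : 0 < θ) (hθ₁ : θ < 1) :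
    DifferentiableOn ℂ (discToStrip θ) (Metric.ball 0 1) := fun ζ hζ => by
  have hζ' : ‖ζ‖ < 1 := by simpa using hζ
  have h1 : 1 - ζ ≠ 0 := fun h => by
    rw [← sub_eq_zero.1 h] at hζ'; simp at hζ'
  refine DifferentiableAt.differentiableWithinAt ?_
  refine DifferentiableAt.div_const (DifferentiableAt.clog ?_ ?_) _
  · fun_prop (disch := assumption)
  · exact Complex.mem_slitPlane_iff.2 (.inr (affine_cayley_im_pos hθ₀ hθ₁ hζ').ne')

lemma discToStrip_zero (hθ₀ : 0 < θ) (hθ₁ : θ < 1) : discToStrip θ 0 = θ := by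
  have h : (Real.cos (Real.pi * θ) + Real.sin (Real.pi * θ) * (Complex.I * (1 + 0) / (1 - 0)) : ℂ) =
      Complex.exp ((Real.pi * θ : ℝ) * Complex.I) := by
    rw [Complex.exp_mul_I, Complex.ofReal_cos, Complex.ofReal_sin]
    ring
  have hpi : (Real.pi : ℂ) ≠ 0 := Complex.ofReal_ne_zero.2 Real.pi_ne_zero
  have hpi' := Real.pi_pos
  rw [discToStrip, h, Complex.log_exp]
  · push_cast
    field_simp
  · rw [Complex.im_ofReal_mul, Complex.I_im]; nlinarith
  · rw [Complex.im_ofReal_mul, Complex.I_im]; nlinarith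

lemma tendsto_discToStrip (hθ₀ : 0 < θ) (hθ₁ : θ < 1) {ε : ℝ} (hε : ε = 1 ∨ ε = -1) (t : ℝ) :
    Tendsto (fun r : ℝ => discToStrip θ (circleMap 0 r (stripAngle θ ε t))) (𝓝[<] 1)
      (𝓝 ((1 - ε) / 2 + Complex.I * t)) := by
  have hs := sin_pi_mul_pos hθ₀ hθ₁
  have hE := Real.exp_pos (-(Real.pi * t))
  set E := Real.exp (-(Real.pi * t)) with hEdef
  set x := (ε * E - Real.cos (Real.pi * θ)) / Real.sin (Real.pi * θ) with hx
  have hx' : Real.cos (Real.pi * θ) + Real.sin (Real.pi * θ) * x = ε * E := by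
    rw [hx]; field_simp; ring
  have h3 : (x + Complex.I : ℂ) ≠ 0 := fun h => by simpa using congrArg Complex.im h
  have h4 : 1 - (x - Complex.I) / (x + Complex.I) ≠ 0 := by
    have : 1 - (x - Complex.I) / (x + Complex.I) = 2 * Complex.I / (x + Complex.I) := by
      field_simp; ring
    rw [this]
    exact div_ne_zero (mul_ne_zero two_ne_zero Complex.I_ne_zero) h3
  have h5 : Complex.I * (1 + (x - Complex.I) / (x + Complex.I)) /
      (1 - (x - Complex.I) / (x + Complex.I)) = x := by
    rw [div_eq_iff h4]
    field_simp
    ring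
  -- The image of the radius under the Cayley transform and the affine map.
  let w : ℝ → ℂ := fun r => Real.cos (Real.pi * θ) + Real.sin (Real.pi * θ) *
    (Complex.I * (1 + circleMap 0 r (stripAngle θ ε t)) / (1 - circleMap 0 r (stripAngle θ ε t)))
  have hcirc : ∀ r : ℝ, circleMap 0 r (stripAngle θ ε t) =
      r * ((x - Complex.I) / (x + Complex.I)) := fun r => circleMap_pi_add_two_mul_arctan r x
  have hw1 : w 1 = (ε * E : ℝ) := by
    simp only [w, hcirc, Complex.ofReal_one, one_mul, h5]
    rw [← hx']
    push_cast
    ring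
  have hwc : ContinuousAt w 1 := by
    have h6 : 1 - ((1 : ℝ) : ℂ) * ((x - Complex.I) / (x + Complex.I)) ≠ 0 := by
      rwa [Complex.ofReal_one, one_mul]
    simp only [w, hcirc]
    fun_prop (disch := assumption)
  have hw : Tendsto w (𝓝[<] 1) (𝓝[{z : ℂ | 0 ≤ z.im}] (ε * E : ℝ)) := by
    refine tendsto_nhdsWithin_iff.2 ⟨?_, ?_⟩
    · rw [← hw1]; exact hwc.tendsto.mono_left nhdsWithin_le_nhds
    · filter_upwards [Ioo_mem_nhdsLT (show (0 : ℝ) < 1 by norm_num)] with r hr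
      refine (affine_cayley_im_pos hθ₀ hθ₁ ?_).le
      rw [norm_circleMap_zero, abs_of_pos hr.1]
      exact hr.2
  have hpi : (Real.pi : ℂ) ≠ 0 := Complex.ofReal_ne_zero.2 Real.pi_ne_zero
  have hlog : Tendsto Complex.log (𝓝[{z : ℂ | 0 ≤ z.im}] (ε * E : ℝ))
      (𝓝 (((1 - ε) / 2 + Complex.I * t) * (Complex.I * Real.pi))) := by
    rcases hε with rfl | rfl
    · have h7 : Complex.log ((1 * E : ℝ) : ℂ) =
          ((1 - (1 : ℝ)) / 2 + Complex.I * t) * (Complex.I * Real.pi) := by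
        rw [one_mul, ← Complex.ofReal_log hE.le, hEdef, Real.log_exp]
        push_cast
        linear_combination (-(t : ℂ) * Real.pi) * Complex.I_sq
      rw [← h7]
      refine (continuousAt_clog ?_).tendsto.mono_left nhdsWithin_le_nhds
      rw [one_mul]
      exact Complex.ofReal_mem_slitPlane.2 hE
    · have h7 : Complex.log ((-1 * E : ℝ) : ℂ) =
          ((1 - (-1 : ℝ)) / 2 + Complex.I * t) * (Complex.I * Real.pi) := by
        rw [neg_one_mul, Complex.log, Complex.arg_ofReal_of_neg (neg_lt_zero.2 hE),
          Complex.norm_real, norm_neg, Real.norm_of_nonneg hE.le, hEdef, Real.log_exp]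
        push_cast
        linear_combination (-(t : ℂ) * Real.pi) * Complex.I_sq
      rw [← h7]
      refine Complex.continuousWithinAt_log_of_re_neg_of_im_zero ?_ (Complex.ofReal_im _)
      rw [Complex.ofReal_re]
      linarith
  have := (hlog.comp hw).div_const (Complex.I * Real.pi)
  rwa [mul_div_cancel_right₀ _ (mul_ne_zero Complex.I_ne_zero hpi)] at this

end

/-- If `f` is analytic in the strip and bounded by `1`, then `-log |f θ|` dominates the integral of
`-log |f|` over the boundary of the strip against harmonic measure. -/
lemma lintegral_negLog_strip_le {f : ℂ → ℂ} (hf : IsAF f)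
    (hb : ∀ z : ℂ, 0 ≤ z.re → z.re ≤ 1 → ‖f z‖ ≤ 1) {θ : ℝ} (hθ₀ : 0 < θ) (hθ₁ : θ < 1)
    (h0 : f θ ≠ 0) :
    (∫⁻ t, ENNReal.ofReal (stripDensity θ 1 t) * negLog ‖f (Complex.I * t)‖) +
      (∫⁻ t, ENNReal.ofReal (stripDensity θ (-1) t) * negLog ‖f (1 + Complex.I * t)‖) ≤
    ENNReal.ofReal (-Real.log ‖f θ‖) := by
  have hε : (-1 : ℝ) ^ 2 = 1 := by norm_num
  have hmem : ∀ ζ ∈ Metric.ball (0 : ℂ) 1, 0 < (discToStrip θ ζ).re ∧ (discToStrip θ ζ).re < 1 :=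
    fun ζ hζ => discToStrip_mem hθ₀ hθ₁ (by simpa using hζ)
  -- The radial boundary values of `|f ∘ discToStrip θ|`. They exist on the two arcs that correspond
  -- to the boundary lines of the strip, and are used only there.
  let b : ℝ → ℝ := fun α =>
    limUnder (𝓝[<] (1 : ℝ)) fun r : ℝ => ‖f (discToStrip θ (circleMap 0 r α))‖
  have hlim : ∀ ε : ℝ, ε = 1 ∨ ε = -1 → ∀ t : ℝ,
      Tendsto (fun r : ℝ => ‖f (discToStrip θ (circleMap 0 r (stripAngle θ ε t)))‖) (𝓝[<] 1)
        (𝓝 ‖f ((1 - ε) / 2 + Complex.I * t)‖) := by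
    intro ε hε' t
    have hre : ((1 - ε) / 2 + Complex.I * t : ℂ).re = (1 - ε) / 2 := by
      rw [← Complex.ofReal_one, ← Complex.ofReal_sub, ← Complex.ofReal_ofNat, ← Complex.ofReal_div]
      simp
    have hc : ContinuousWithinAt f {z : ℂ | 0 ≤ z.re ∧ z.re ≤ 1} ((1 - ε) / 2 + Complex.I * t) := by
      refine hf.continuous _ ?_
      simp only [mem_ofPred_eq, hre]
      rcases hε' with rfl | rfl <;> norm_num
    refine (hc.tendsto.comp (tendsto_nhdsWithin_iff.2
      ⟨tendsto_discToStrip hθ₀ hθ₁ hε' t, ?_⟩)).norm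
    filter_upwards [Ioo_mem_nhdsLT (show (0 : ℝ) < 1 by norm_num)] with r hr
    have := discToStrip_mem hθ₀ hθ₁ (ζ := circleMap 0 r (stripAngle θ ε t))
      (by rw [norm_circleMap_zero, abs_of_pos hr.1]; exact hr.2)
    exact ⟨this.1.le, this.2.le⟩
  have hb' : ∀ ε : ℝ, ε = 1 ∨ ε = -1 → ∀ t : ℝ,
      b (stripAngle θ ε t) = ‖f ((1 - ε) / 2 + Complex.I * t)‖ := fun ε hε' t =>
    (hlim ε hε' t).limUnder_eq
  -- Only the two arcs are integrated over: they are disjoint, and that they exhaust the circle up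
  -- to two points is not needed for the inequality.
  have key := lintegral_negLog_boundary_le (F := fun ζ => f (discToStrip θ ζ)) (b := b)
    (hf.analytic.comp (differentiableOn_discToStrip hθ₀ hθ₁) hmem)
    (by rwa [discToStrip_zero hθ₀ hθ₁])
    (fun ζ hζ => hb _ (hmem ζ hζ).1.le (hmem ζ hζ).2.le)
    ((measurableSet_range_stripAngle hθ₀ hθ₁ (one_pow 2)).union
      (measurableSet_range_stripAngle hθ₀ hθ₁ hε))
    (by rintro _ (⟨t, rfl⟩ | ⟨t, rfl⟩) <;> exact stripAngle_mem _ t)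
    (by
      rintro _ (⟨t, rfl⟩ | ⟨t, rfl⟩)
      · rw [hb' 1 (.inl rfl)]; exact hlim 1 (.inl rfl) t
      · rw [hb' (-1) (.inr rfl)]; exact hlim (-1) (.inr rfl) t)
  have hmul : ∀ ε t, ENNReal.ofReal (2 * Real.pi * stripDensity θ ε t) =
      ENNReal.ofReal (2 * Real.pi) * ENNReal.ofReal (stripDensity θ ε t) := fun ε t =>
    ENNReal.ofReal_mul (by positivity)
  have hone : ((1 - (1 : ℝ)) / 2 : ℂ) = 0 := by push_cast; norm_num
  have hneg : ((1 - (-1 : ℝ)) / 2 : ℂ) = 1 := by push_cast; norm_num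
  rw [lintegral_union (measurableSet_range_stripAngle hθ₀ hθ₁ hε)
    (disjoint_range_stripAngle hθ₀ hθ₁), lintegral_range_stripAngle hθ₀ hθ₁ (one_pow 2),
    lintegral_range_stripAngle hθ₀ hθ₁ hε, discToStrip_zero hθ₀ hθ₁,
    ENNReal.ofReal_mul (by positivity)] at key
  simp only [hmul] at key
  simp only [mul_assoc, hb' 1 (.inl rfl), hb' (-1) (.inr rfl), hone, hneg, zero_add] at key
  rw [lintegral_const_mul' _ _ ENNReal.ofReal_ne_top, lintegral_const_mul' _ _ ENNReal.ofReal_ne_top,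
    ← mul_add] at key
  exact (ENNReal.mul_le_mul_iff_right (ENNReal.ofReal_pos.2 (by positivity)).ne'
    ENNReal.ofReal_ne_top).1 key

/-- If the integral of `-log u` against a positive density is finite, then `u` vanishes only on a
null set, and the value `Real.log 0 = 0` does not matter to the Bochner integral. -/
lemma integrable_mul_log_of_lintegral_negLog_ne_top {k u : ℝ → ℝ} (hk : ∀ t, 0 < k t)
    (hkm : Measurable k) (hum : Measurable u) (hu₀ : ∀ t, 0 ≤ u t) (hu₁ : ∀ t, u t ≤ 1)
    (h : ∫⁻ t, ENNReal.ofReal (k t) * negLog (u t) ≠ ∞) :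
    (∀ᵐ t, u t ≠ 0) ∧ Integrable (fun t => k t * Real.log (u t)) ∧
      ∫⁻ t, ENNReal.ofReal (k t) * negLog (u t) = ENNReal.ofReal (-∫ t, k t * Real.log (u t)) := by
  have hm : Measurable fun t => ENNReal.ofReal (k t) * negLog (u t) :=
    hkm.ennreal_ofReal.mul (continuous_negLog.measurable.comp hum)
  have hne : ∀ᵐ t, u t ≠ 0 := by
    filter_upwards [ae_lt_top hm h] with t ht h0
    rw [h0, negLog_zero, ENNReal.mul_top (ENNReal.ofReal_pos.2 (hk t)).ne'] at ht
    exact lt_irrefl _ ht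
  have hpos : ∀ t, 0 ≤ -(k t * Real.log (u t)) := fun t =>
    neg_nonneg.2 (mul_nonpos_of_nonneg_of_nonpos (hk t).le (Real.log_nonpos (hu₀ t) (hu₁ t)))
  have heq : ∫⁻ t, ENNReal.ofReal (k t) * negLog (u t) =
      ∫⁻ t, ENNReal.ofReal (-(k t * Real.log (u t))) := by
    refine lintegral_congr_ae (hne.mono fun t ht => ?_)
    simp only
    rw [negLog_of_pos ((hu₀ t).lt_of_ne' ht), ← ENNReal.ofReal_mul (hk t).le, mul_neg]
  have hint : Integrable fun t => -(k t * Real.log (u t)) := by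
    refine ⟨(hkm.mul hum.log).neg.aestronglyMeasurable, ?_⟩
    rw [hasFiniteIntegral_iff_ofReal (.of_forall hpos), ← heq]
    exact h.lt_top
  refine ⟨hne, by simpa using hint.neg, ?_⟩
  rw [heq, ← integral_neg, ofReal_integral_eq_lintegral_ofReal hint (.of_forall hpos)]

section

variable {X : Type*} [NormedAddCommGroup X] [NormedSpace ℂ X] {f : ℂ → X}

lemma IsAF.continuous_left (hf : IsAF f) : Continuous fun t : ℝ => f (Complex.I * t) :=
  hf.continuous.comp_continuous (by fun_prop) fun t => by simp

lemma IsAF.continuous_right (hf : IsAF f) : Continuous fun t : ℝ => f (1 + Complex.I * t) :=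
  hf.continuous.comp_continuous (by fun_prop) fun t => by simp

end

/-- Hirschman's refinement of the three lines theorem: `log |f|` is dominated at a point `θ` of the
strip, where `f θ ≠ 0`, by its integral over the boundary against harmonic measure. -/
lemma log_norm_le_integral_strip {f : ℂ → ℂ} (hf : IsAF f) {θ : ℝ} (hθ₀ : 0 < θ) (hθ₁ : θ < 1)
    (h0 : f θ ≠ 0) :
    (∀ᵐ t : ℝ, f (Complex.I * t) ≠ 0) ∧ (∀ᵐ t : ℝ, f (1 + Complex.I * t) ≠ 0) ∧
    Integrable (fun t : ℝ => stripDensity θ 1 t * Real.log ‖f (Complex.I * t)‖) ∧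
    Integrable (fun t : ℝ => stripDensity θ (-1) t * Real.log ‖f (1 + Complex.I * t)‖) ∧
    Real.log ‖f θ‖ ≤ (∫ t : ℝ, stripDensity θ 1 t * Real.log ‖f (Complex.I * t)‖) +
      ∫ t : ℝ, stripDensity θ (-1) t * Real.log ‖f (1 + Complex.I * t)‖ := by
  have hε : (-1 : ℝ) ^ 2 = 1 := by norm_num
  obtain ⟨C, hC⟩ := hf.bounded
  have hM : 0 < max C 1 := lt_max_of_lt_right one_pos
  have hMC : ∀ z : ℂ, 0 ≤ z.re → z.re ≤ 1 → ‖f z‖ ≤ max C 1 := fun z h h' =>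
    (hC z h h').trans (le_max_left _ _)
  generalize max C 1 = M at hM hMC
  -- Dividing `f` by a bound `M` reduces to functions bounded by `1`.
  have hnorm : ∀ z, ‖(M : ℂ)⁻¹ * f z‖ = M⁻¹ * ‖f z‖ := fun z => by
    rw [norm_mul, norm_inv, Complex.norm_real, Real.norm_of_nonneg hM.le]
  have hb : ∀ z : ℂ, 0 ≤ z.re → z.re ≤ 1 → ‖(M : ℂ)⁻¹ * f z‖ ≤ 1 := fun z h h' => by
    rw [hnorm, inv_mul_le_iff₀ hM, mul_one]
    exact hMC z h h'
  have hg : IsAF fun z => (M : ℂ)⁻¹ * f z :=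
    ⟨hf.analytic.const_mul _, continuousOn_const.mul hf.continuous, 1, hb⟩
  have hM' : (M : ℂ)⁻¹ ≠ 0 := inv_ne_zero (Complex.ofReal_ne_zero.2 hM.ne')
  have key := lintegral_negLog_strip_le hg hb hθ₀ hθ₁ (mul_ne_zero hM' h0)
  have hlog : ∀ z, f z ≠ 0 → Real.log ‖(M : ℂ)⁻¹ * f z‖ = Real.log ‖f z‖ - Real.log M :=
    fun z hz => by
      rw [hnorm, Real.log_mul (inv_ne_zero hM.ne') (norm_ne_zero_iff.2 hz), Real.log_inv]
      ring
  have hfin := (key.trans_lt ENNReal.ofReal_lt_top).ne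
  obtain ⟨hne₀, hint₀, heq₀⟩ := integrable_mul_log_of_lintegral_negLog_ne_top
    (stripDensity_pos hθ₀ hθ₁ (one_pow 2)) (continuous_stripDensity hθ₀ hθ₁ (one_pow 2)).measurable
    hg.continuous_left.norm.measurable (fun t => norm_nonneg _) (fun t => hb _ (by simp) (by simp))
    (ENNReal.add_ne_top.1 hfin).1
  obtain ⟨hne₁, hint₁, heq₁⟩ := integrable_mul_log_of_lintegral_negLog_ne_top
    (stripDensity_pos hθ₀ hθ₁ hε) (continuous_stripDensity hθ₀ hθ₁ hε).measurable
    hg.continuous_right.norm.measurable (fun t => norm_nonneg _) (fun t => hb _ (by simp) (by simp))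
    (ENNReal.add_ne_top.1 hfin).2
  have hne₀' : ∀ᵐ t : ℝ, f (Complex.I * t) ≠ 0 := hne₀.mono fun t ht h => ht (by rw [h]; simp)
  have hne₁' : ∀ᵐ t : ℝ, f (1 + Complex.I * t) ≠ 0 := hne₁.mono fun t ht h => ht (by rw [h]; simp)
  have hc₀ := (integrable_stripDensity hθ₀ hθ₁ (one_pow 2)).mul_const (Real.log M)
  have hc₁ := (integrable_stripDensity hθ₀ hθ₁ hε).mul_const (Real.log M)
  have hae₀ : (fun t : ℝ => stripDensity θ 1 t * Real.log ‖f (Complex.I * t)‖) =ᵐ[volume]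
      fun t => stripDensity θ 1 t * Real.log ‖(M : ℂ)⁻¹ * f (Complex.I * t)‖ +
        stripDensity θ 1 t * Real.log M := by
    filter_upwards [hne₀'] with t ht
    rw [hlog _ ht]; ring
  have hae₁ : (fun t : ℝ => stripDensity θ (-1) t * Real.log ‖f (1 + Complex.I * t)‖) =ᵐ[volume]
      fun t => stripDensity θ (-1) t * Real.log ‖(M : ℂ)⁻¹ * f (1 + Complex.I * t)‖ +
        stripDensity θ (-1) t * Real.log M := by
    filter_upwards [hne₁'] with t ht
    rw [hlog _ ht]; ring
  refine ⟨hne₀', hne₁', (hint₀.add hc₀).congr hae₀.symm, (hint₁.add hc₁).congr hae₁.symm, ?_⟩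
  have hnp : ∀ (ε : ℝ) (z : ℝ → ℂ), ε ^ 2 = 1 → (∀ t, ‖(M : ℂ)⁻¹ * f (z t)‖ ≤ 1) →
      0 ≤ -∫ t, stripDensity θ ε t * Real.log ‖(M : ℂ)⁻¹ * f (z t)‖ := fun ε z hε hz =>
    neg_nonneg.2 (integral_nonpos fun t => mul_nonpos_of_nonneg_of_nonpos
      (stripDensity_pos hθ₀ hθ₁ hε t).le (Real.log_nonpos (norm_nonneg _) (hz t)))
  have h0' : 0 ≤ -Real.log ‖(M : ℂ)⁻¹ * f θ‖ :=
    neg_nonneg.2 (Real.log_nonpos (norm_nonneg _)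
      (hb _ (by simpa using hθ₀.le) (by simpa using hθ₁.le)))
  rw [heq₀, heq₁, ← ENNReal.ofReal_add (hnp 1 _ (one_pow 2) fun t => hb _ (by simp) (by simp))
    (hnp (-1) _ hε fun t => hb _ (by simp) (by simp)), ENNReal.ofReal_le_ofReal_iff h0',
    hlog _ h0] at key
  rw [integral_congr_ae hae₀, integral_congr_ae hae₁, integral_add hint₀ hc₀,
    integral_add hint₁ hc₁, integral_mul_const, integral_mul_const,
    integral_stripDensity_one hθ₀ hθ₁, integral_stripDensity_neg_one hθ₀ hθ₁]
  linarith

/-! ### Minors and the Cauchy–Binet formula -/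

section

variable {n : Type*} [Fintype n] {k : ℕ}

lemma det_mul_eq_sum (A : Matrix (Fin k) n ℂ) (B : Matrix n (Fin k) ℂ) :
    (A * B).det = ∑ f : Fin k → n, (∏ i, A i (f i)) * (B.submatrix f id).det := by
  have h : A * B = fun i => ∑ j, A i j • B j := by
    ext i l
    rw [Matrix.mul_apply, Finset.sum_apply]
    rfl
  change Matrix.detRowAlternating (A * B) = _
  rw [h, ← AlternatingMap.coe_multilinearMap, MultilinearMap.map_sum]
  refine Finset.sum_congr rfl fun f _ => ?_
  rw [MultilinearMap.map_smul_univ]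
  rfl

/-- The Cauchy–Binet formula, summed over all maps `Fin k → n` instead of the `k`-element subsets
of `n`, so that each minor appears `k!` times. -/
lemma factorial_mul_det_mul (A : Matrix (Fin k) n ℂ) (B : Matrix n (Fin k) ℂ) :
    (k.factorial : ℂ) * (A * B).det =
      ∑ f : Fin k → n, (A.submatrix id f).det * (B.submatrix f id).det := by
  have h : ∀ σ : Equiv.Perm (Fin k), (A * B).det =
      ∑ f : Fin k → n, (Equiv.Perm.sign σ : ℂ) * (∏ i, A i (f (σ i))) * (B.submatrix f id).det := by
    intro σ
    rw [det_mul_eq_sum, ← (Equiv.arrowCongr σ.symm (Equiv.refl n)).sum_comp]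
    refine Finset.sum_congr rfl fun f _ => ?_
    have h1 : (B.submatrix (Equiv.arrowCongr σ.symm (Equiv.refl n) f) id) =
        (B.submatrix f id).submatrix σ id := by ext; rfl
    rw [h1, Matrix.det_permute]
    simp only [Equiv.arrowCongr_apply, Equiv.symm_symm, Equiv.coe_refl, Function.comp_apply, id]
    ring
  calc (k.factorial : ℂ) * (A * B).det
      = ∑ σ : Equiv.Perm (Fin k), (A * B).det := by
        rw [Finset.sum_const, Finset.card_univ, Fintype.card_perm, Fintype.card_fin, nsmul_eq_mul]
    _ = ∑ σ : Equiv.Perm (Fin k), ∑ f : Fin k → n,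
          (Equiv.Perm.sign σ : ℂ) * (∏ i, A i (f (σ i))) * (B.submatrix f id).det :=
        Finset.sum_congr rfl fun σ _ => h σ
    _ = _ := by
        rw [Finset.sum_comm]
        refine Finset.sum_congr rfl fun f _ => ?_
        rw [← Finset.sum_mul, ← Matrix.det_transpose (A.submatrix id f),
          Matrix.det_apply' (A.submatrix id f).transpose]
        rfl

/-- The Cauchy–Binet formula for a Gram determinant: the minors enter with squared moduli. -/
lemma factorial_mul_norm_det_gram (V : Matrix n (Fin k) ℂ) :
    (k.factorial : ℝ) * ‖(V.conjTranspose * V).det‖ =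
      ∑ f : Fin k → n, ‖(V.submatrix f id).det‖ ^ 2 := by
  have h : (k.factorial : ℂ) * (V.conjTranspose * V).det =
      ((∑ f : Fin k → n, ‖(V.submatrix f id).det‖ ^ 2 : ℝ) : ℂ) := by
    rw [factorial_mul_det_mul, Complex.ofReal_sum]
    refine Finset.sum_congr rfl fun f _ => ?_
    rw [← Matrix.conjTranspose_submatrix, Matrix.det_conjTranspose, mul_comm, RCLike.star_def,
      Complex.mul_conj, Complex.normSq_eq_norm_sq]
  have h' := congrArg norm h
  rwa [norm_mul, Complex.norm_natCast, Complex.norm_real, Real.norm_of_nonneg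
    (Finset.sum_nonneg fun f _ => sq_nonneg _)] at h'

/-- The Cauchy–Schwarz inequality for the sum in the Cauchy–Binet formula. -/
lemma norm_det_mul_sq_le (P B : Matrix n (Fin k) ℂ) :
    ‖(P.conjTranspose * B).det‖ ^ 2 ≤
      ‖(P.conjTranspose * P).det‖ * ‖(B.conjTranspose * B).det‖ := by
  have hk : (0 : ℝ) < k.factorial := by positivity
  have h1 : (k.factorial : ℝ) * ‖(P.conjTranspose * B).det‖ ≤
      ∑ f : Fin k → n, ‖(P.submatrix f id).det‖ * ‖(B.submatrix f id).det‖ := by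
    rw [← Complex.norm_natCast, ← norm_mul, factorial_mul_det_mul]
    refine (norm_sum_le _ _).trans (Finset.sum_le_sum fun f _ => ?_)
    rw [norm_mul, ← Matrix.conjTranspose_submatrix, Matrix.det_conjTranspose, norm_star]
  have h2 := Finset.sum_mul_sq_le_sq_mul_sq Finset.univ
    (fun f : Fin k → n => ‖(P.submatrix f id).det‖) (fun f => ‖(B.submatrix f id).det‖)
  rw [← factorial_mul_norm_det_gram, ← factorial_mul_norm_det_gram] at h2
  have h3 := (pow_le_pow_left₀ (by positivity) h1 2).trans h2
  have h4 : (0 : ℝ) < (k.factorial : ℝ) ^ 2 := by positivity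
  refine le_of_mul_le_mul_left ?_ h4
  linarith

end

lemma prod_le_prod_range_of_antitone {D : ℕ → ℝ} (hD : Antitone D) (h0 : ∀ n, 0 ≤ D n)
    (s : Finset ℕ) : ∏ i ∈ s, D i ≤ ∏ i ∈ Finset.range s.card, D i := by
  induction s using Finset.induction_on_max with
  | empty => simp
  | insert a s hs ih =>
    have ha : a ∉ s := fun h => lt_irrefl _ (hs a h)
    rw [Finset.prod_insert ha, Finset.card_insert_of_notMem ha, Finset.prod_range_succ, mul_comm]
    have hc : s.card ≤ a := by
      simpa using Finset.card_le_card (show s ⊆ Finset.range a from fun x hx =>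
        Finset.mem_range.2 (hs x hx))
    exact mul_le_mul ih (hD hc) (h0 a) (Finset.prod_nonneg fun i _ => h0 i)

lemma prod_comp_le_of_injective {d k : ℕ} {D : ℕ → ℝ} (hD : Antitone D) (h0 : ∀ n, 0 ≤ D n)
    {f : Fin k → Fin d} (hf : Function.Injective f) :
    ∏ i, D (f i) ≤ ∏ i ∈ Finset.range k, D i := by
  have hinj : Function.Injective fun i => (f i : ℕ) := Fin.val_injective.comp hf
  have h := prod_le_prod_range_of_antitone hD h0 (Finset.univ.image fun i => (f i : ℕ))
  rwa [Finset.prod_image hinj.injOn, Finset.card_image_of_injective _ hinj, Finset.card_univ,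
    Fintype.card_fin] at h

/-- The determinant of a `k`-dimensional compression of a positive semidefinite diagonal matrix is
at most the product of its `k` largest entries. -/
lemma norm_det_compression_diagonal_le {d k : ℕ} {D : ℕ → ℝ} (hD : Antitone D)
    (h0 : ∀ n, 0 ≤ D n) (V : Matrix (Fin d) (Fin k) ℂ) :
    ‖(V.conjTranspose * Matrix.diagonal (fun i : Fin d => (D i : ℂ)) * V).det‖ ≤
      (∏ i ∈ Finset.range k, D i) * ‖(V.conjTranspose * V).det‖ := by
  have hk : (0 : ℝ) < k.factorial := by positivity
  refine le_of_mul_le_mul_left ?_ hk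
  rw [mul_left_comm, factorial_mul_norm_det_gram, Finset.mul_sum, Matrix.mul_assoc,
    ← Complex.norm_natCast, ← norm_mul, factorial_mul_det_mul]
  refine (norm_sum_le _ _).trans (Finset.sum_le_sum fun f _ => ?_)
  have h1 : (Matrix.diagonal (fun i : Fin d => (D i : ℂ)) * V).submatrix f id =
      Matrix.diagonal (fun i => (D (f i) : ℂ)) * V.submatrix f id := by
    ext i j
    simp [Matrix.diagonal_mul]
  rw [h1, Matrix.det_mul, Matrix.det_diagonal, norm_mul, norm_mul, ← Matrix.conjTranspose_submatrix,
    Matrix.det_conjTranspose, norm_star, ← Complex.ofReal_prod, Complex.norm_real,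
    Real.norm_of_nonneg (Finset.prod_nonneg fun i _ => h0 _)]
  by_cases hf : Function.Injective f
  · have := mul_le_mul_of_nonneg_right (prod_comp_le_of_injective hD h0 hf)
      (sq_nonneg ‖(V.submatrix f id).det‖)
    linarith
  · obtain ⟨i, j, hij, hne⟩ : ∃ i j, f i = f j ∧ i ≠ j := by
      simpa [Function.Injective] using hf
    rw [Matrix.det_zero_of_row_eq hne (by ext l; simp [hij])]
    simp

/-! ### Schatten norms and singular values -/

section

variable {d : ℕ}

open scoped MatrixOrder ComplexOrder in
lemma continuous_schattenNorm {p : ℝ≥0∞} (hp : p ≠ 0) :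
    Continuous (schattenNorm (d := d) p) := by
  unfold schattenNorm
  split_ifs with h
  · exact continuous_norm (E := Matrix (Fin d) (Fin d) ℂ)
  · have hp' : 0 < p.toReal := ENNReal.toReal_pos hp h
    have h1 : Continuous fun A : Matrix (Fin d) (Fin d) ℂ => CFC.abs A ^ p.toReal := by
      have h2 : Continuous fun A : Matrix (Fin d) (Fin d) ℂ => CFC.abs A ^ p.toReal.toNNReal :=
        (CFC.continuousOn_nnrpow p.toReal.toNNReal).comp_continuous CFC.continuous_abs
          fun A => CFC.abs_nonneg A
      refine h2.congr fun A => ?_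
      rw [CFC.nnrpow_eq_rpow (Real.toNNReal_pos.2 hp'), Real.coe_toNNReal _ hp'.le]
    exact (Complex.continuous_re.comp h1.matrix_trace).rpow_const
      fun A => .inr (by positivity)

open scoped MatrixOrder ComplexOrder in
lemma trace_abs_rpow (A : Matrix (Fin d) (Fin d) ℂ) {p : ℝ} (hp : 0 < p) :
    Matrix.trace (CFC.abs A ^ p) =
      ∑ i, (((Matrix.isHermitian_conjTranspose_mul_self A).eigenvalues i ^ (p / 2) : ℝ) : ℂ) := by
  have hA := Matrix.isHermitian_conjTranspose_mul_self A
  have hnn : 0 ≤ A.conjTranspose * A := (Matrix.posSemidef_conjTranspose_mul_self A).nonneg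
  have h1 : CFC.abs A ^ p = cfc (fun x : ℝ => x ^ (p / 2)) (A.conjTranspose * A) := by
    have := CFC.rpow_sqrt_nnreal (a := A.conjTranspose * A) (x := p.toNNReal) hnn
    rw [Real.coe_toNNReal _ hp.le] at this
    rw [← CFC.rpow_eq_cfc_real hnn, ← this]
    rfl
  rw [h1, hA.cfc_eq, Matrix.IsHermitian.cfc, Unitary.conjStarAlgAut_apply, Matrix.trace_mul_comm,
    ← mul_assoc, Unitary.coe_star_mul_self, one_mul, Matrix.trace_diagonal]
  rfl

lemma sqrt_eigenvalues_le_norm (A : Matrix (Fin d) (Fin d) ℂ) (i : Fin d) :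
    √((Matrix.isHermitian_conjTranspose_mul_self A).eigenvalues i) ≤ ‖A‖ := by
  have hA := Matrix.isHermitian_conjTranspose_mul_self A
  rw [← Real.sqrt_mul_self (norm_nonneg A), ← Matrix.l2_opNorm_conjTranspose_mul_self]
  refine Real.sqrt_le_sqrt ((le_abs_self _).trans ?_)
  have h := hA.eigenvalues_mem_spectrum_real i
  have : Nonempty (Fin d) := ⟨i⟩
  have : NormOneClass (Matrix (Fin d) (Fin d) ℂ) := ⟨CStarRing.norm_one⟩
  have := spectrum.norm_le_norm_of_mem h
  simpa using this

/-- `Q` and `D` diagonalise `A* A`: the columns of the unitary matrix `Q` are eigenvectors for the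
eigenvalues `D 0 ≥ D 1 ≥ …`, which are the squares of the singular values of `A`. The sequence `D`
is indexed by `ℕ` and vanishes from the index `d` on. The last two fields record how the Schatten
norms of `A` depend on its singular values `√(D i)`. -/
structure IsSortedDiagonalization (A Q : Matrix (Fin d) (Fin d) ℂ) (D : ℕ → ℝ) : Prop where
  antitone : Antitone D
  nonneg : ∀ i, 0 ≤ D i
  unitary : Q * Q.conjTranspose = 1
  eq_diagonal : Q.conjTranspose * (A.conjTranspose * A) * Q =
    Matrix.diagonal fun i : Fin d => (D i : ℂ)
  zero_of_le : ∀ i, d ≤ i → D i = 0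
  schattenNorm_eq : ∀ p : ℝ≥0∞, p ≠ 0 → p ≠ ∞ →
    schattenNorm p A = (∑ i ∈ Finset.range d, √(D i) ^ p.toReal) ^ (1 / p.toReal)
  sqrt_le : ∀ i, √(D i) ≤ schattenNorm ∞ A

open scoped MatrixOrder ComplexOrder in
lemma exists_isSortedDiagonalization (A : Matrix (Fin d) (Fin d) ℂ) :
    ∃ Q D, IsSortedDiagonalization A Q D := by
  have hA := Matrix.isHermitian_conjTranspose_mul_self A
  have hnn : ∀ i, 0 ≤ hA.eigenvalues i :=
    (Matrix.posSemidef_conjTranspose_mul_self A).eigenvalues_nonneg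
  let σ := Tuple.sort fun i => -hA.eigenvalues i
  have hσ : Antitone fun i => hA.eigenvalues (σ i) := fun i j hij =>
    neg_le_neg_iff.1 (Tuple.monotone_sort (fun i => -hA.eigenvalues i) hij)
  let U : Matrix (Fin d) (Fin d) ℂ := hA.eigenvectorUnitary
  have hU : U * U.conjTranspose = 1 := Unitary.coe_mul_star_self hA.eigenvectorUnitary
  have hU' : U.conjTranspose * U = 1 := Unitary.coe_star_mul_self hA.eigenvectorUnitary
  let D : ℕ → ℝ := fun n => if h : n < d then hA.eigenvalues (σ ⟨n, h⟩) else 0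
  have hD : ∀ i : Fin d, D i = hA.eigenvalues (σ i) := fun i => by simp [D]
  have hD' : ∀ i, d ≤ i → D i = 0 := fun i hi => dif_neg (not_lt.2 hi)
  have hD0 : ∀ i, 0 ≤ D i := fun i => by
    simp only [D]; split_ifs; exacts [hnn _, le_rfl]
  have hnorm : schattenNorm ∞ A = ‖A‖ := if_pos rfl
  refine ⟨U.submatrix id σ, D, ?_, hD0, ?_, ?_, hD', ?_, ?_⟩
  · intro i j hij
    by_cases hj : j < d
    · have hi := hij.trans_lt hj
      simp only [D, dif_pos hi, dif_pos hj]
      exact hσ (Fin.mk_le_mk.2 hij)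
    · rw [hD' j (not_lt.1 hj)]
      exact hD0 i
  · rw [Matrix.conjTranspose_submatrix, Matrix.submatrix_mul_equiv, hU, Matrix.submatrix_id_id]
  · have h1 := hA.spectral_theorem
    rw [Unitary.conjStarAlgAut_apply] at h1
    have h2 : U.conjTranspose * (A.conjTranspose * A) * U =
        Matrix.diagonal (RCLike.ofReal ∘ hA.eigenvalues) := by
      conv_lhs => rw [h1]
      change U.conjTranspose * (U * _ * U.conjTranspose) * U = _
      rw [Matrix.mul_assoc U, ← Matrix.mul_assoc U.conjTranspose U, hU', Matrix.one_mul,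
        Matrix.mul_assoc, hU', Matrix.mul_one]
    rw [Matrix.conjTranspose_submatrix]
    have h3 : U.conjTranspose.submatrix σ id * (A.conjTranspose * A) * U.submatrix id σ =
        (U.conjTranspose * (A.conjTranspose * A) * U).submatrix σ σ := by
      ext i j
      simp [Matrix.mul_apply]
    rw [h3, h2, Matrix.submatrix_diagonal_equiv]
    congr 1
    ext i
    simp [hD]
  · intro p hp hp'
    have hpos := ENNReal.toReal_pos hp hp'
    rw [schattenNorm, if_neg hp', trace_abs_rpow A hpos, ← Complex.ofReal_sum, Complex.ofReal_re,
      Finset.sum_range, ← Equiv.sum_comp σ]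
    congr 1
    refine Finset.sum_congr rfl fun i _ => ?_
    rw [hD, Real.sqrt_eq_rpow, ← Real.rpow_mul (hnn _)]
    congr 1
    ring
  · intro i
    rw [hnorm]
    by_cases hi : i < d
    · simp only [D, dif_pos hi]
      exact sqrt_eigenvalues_le_norm A _
    · rw [hD' i (not_lt.1 hi), Real.sqrt_zero]
      exact norm_nonneg A

end

/-! ### Gibbs' variational principle and minors along singular vectors -/

/-- Gibbs' variational principle for the entropy of a probability vector. -/
lemma gibbs_le_log_sum_rpow {ι : Type*} {t : Finset ι} {w s : ι → ℝ} (hw : ∀ i ∈ t, 0 ≤ w i)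
    (hw1 : ∑ i ∈ t, w i = 1) (hs : ∀ i ∈ t, 0 ≤ s i) (hws : ∀ i ∈ t, 0 < w i → 0 < s i)
    {q : ℝ} (hq : 0 < q) :
    ∑ i ∈ t, w i * Real.log (s i) + (-∑ i ∈ t, w i * Real.log (w i)) * (1 / q) ≤
      1 / q * Real.log (∑ i ∈ t, s i ^ q) := by
  set S := ∑ i ∈ t, s i ^ q with hS
  have hsq : ∀ i ∈ t, 0 ≤ s i ^ q := fun i hi => Real.rpow_nonneg (hs i hi) q
  obtain ⟨j, hj, hjw⟩ : ∃ j ∈ t, 0 < w j := by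
    by_contra! h
    have := Finset.sum_nonpos h
    rw [hw1] at this
    linarith
  have hSpos : 0 < S := Finset.sum_pos' hsq ⟨j, hj, Real.rpow_pos_of_pos (hws j hj hjw) q⟩
  -- `log x ≤ x - 1` at `x = s i ^ q / (w i * S)`, weighted by `w i`.
  have key : ∀ i ∈ t, q * (w i * Real.log (s i)) - w i * Real.log (w i) - w i * Real.log S ≤
      s i ^ q / S - w i := by
    intro i hi
    rcases (hw i hi).eq_or_lt with h | h
    · rw [← h]
      simpa using div_nonneg (hsq i hi) hSpos.le
    · have hsi := hws i hi h
      have hsi' := Real.rpow_pos_of_pos hsi q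
      have hl := Real.log_le_sub_one_of_pos (show 0 < s i ^ q / (w i * S) by positivity)
      rw [Real.log_div hsi'.ne' (by positivity), Real.log_mul h.ne' hSpos.ne',
        Real.log_rpow hsi] at hl
      have := mul_le_mul_of_nonneg_left hl h.le
      have h2 : w i * (s i ^ q / (w i * S) - 1) = s i ^ q / S - w i := by field_simp
      rw [h2] at this
      linarith
  have hsum := Finset.sum_le_sum key
  rw [Finset.sum_sub_distrib, Finset.sum_sub_distrib, Finset.sum_sub_distrib, ← Finset.mul_sum,
    ← Finset.sum_mul, ← Finset.sum_div, hw1, ← hS, div_self hSpos.ne', one_mul] at hsum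
  have h3 : ∑ i ∈ t, w i * Real.log (s i) + (-∑ i ∈ t, w i * Real.log (w i)) * (1 / q) =
      1 / q * (q * ∑ i ∈ t, w i * Real.log (s i) - ∑ i ∈ t, w i * Real.log (w i)) := by
    field_simp
    ring
  rw [h3]
  exact mul_le_mul_of_nonneg_left (by linarith) (by positivity)

/-- Summation by parts. -/
lemma sum_sub_succ_mul_sum (w a : ℕ → ℝ) (n : ℕ) :
    ∑ k ∈ Finset.range n, (w k - w (k + 1)) * ∑ i ∈ Finset.range (k + 1), a i =
      ∑ i ∈ Finset.range n, w i * a i - w n * ∑ i ∈ Finset.range n, a i := by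
  induction n with
  | zero => simp
  | succ n ih =>
    rw [Finset.sum_range_succ, ih, Finset.sum_range_succ _ n, Finset.sum_range_succ _ n]
    ring

section

variable {d : ℕ}

/-- The `(k + 1) × (k + 1)` minor of `B` with respect to the leading left and right singular vectors
of `A`, where `Q` and `D` diagonalise `A* A`. The left singular vectors are the normalised columns
of `A * Q`; the normalisation is put into the denominator. -/
noncomputable def singularMinor (A Q : Matrix (Fin d) (Fin d) ℂ) (D : ℕ → ℝ) (k : Fin d)
    (B : Matrix (Fin d) (Fin d) ℂ) : ℂ :=
  (((A * Q).submatrix id (Fin.castLE k.2 : Fin (k + 1) → Fin d)).conjTranspose *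
    (B * Q.submatrix id (Fin.castLE k.2 : Fin (k + 1) → Fin d))).det /
      ∏ i ∈ Finset.range (k + 1), (√(D i) : ℂ)

lemma differentiable_singularMinor (A Q : Matrix (Fin d) (Fin d) ℂ) (D : ℕ → ℝ) (k : Fin d) :
    Differentiable ℂ (singularMinor A Q D k) := by
  have h : ∀ i j, Differentiable ℂ fun B : Matrix (Fin d) (Fin d) ℂ => B i j := fun i j =>
    (LinearMap.toContinuousLinearMap (Matrix.entryLinearMap ℂ ℂ i j)).differentiable
  unfold singularMinor
  simp only [Matrix.det_apply, Matrix.mul_apply, div_eq_mul_inv]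
  refine Differentiable.mul_const ?_ _
  fun_prop

variable {A Q : Matrix (Fin d) (Fin d) ℂ} {D : ℕ → ℝ}

lemma IsSortedDiagonalization.gram_submatrix (h : IsSortedDiagonalization A Q D) (k : Fin d) :
    ((A * Q).submatrix id (Fin.castLE k.2 : Fin (k + 1) → Fin d)).conjTranspose *
      (A * Q).submatrix id (Fin.castLE k.2 : Fin (k + 1) → Fin d) =
    Matrix.diagonal fun i : Fin (k + 1) => (D i : ℂ) := by
  have h1 : ((A * Q).submatrix id (Fin.castLE k.2 : Fin (k + 1) → Fin d)).conjTranspose *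
      (A * Q).submatrix id (Fin.castLE k.2 : Fin (k + 1) → Fin d) =
      (Q.conjTranspose * (A.conjTranspose * A) * Q).submatrix (Fin.castLE k.2) (Fin.castLE k.2) := by
    rw [Matrix.conjTranspose_submatrix, ← Matrix.submatrix_mul _ _ _ _ _ Function.bijective_id,
      Matrix.conjTranspose_mul]
    simp only [Matrix.mul_assoc]
  rw [h1, h.eq_diagonal]
  ext i j
  simp [Matrix.diagonal_apply]

lemma IsSortedDiagonalization.singularMinor_self (h : IsSortedDiagonalization A Q D) {k : Fin d}
    (hk : 0 < D k) :
    singularMinor A Q D k A = ((∏ i ∈ Finset.range (k + 1), √(D i) : ℝ) : ℂ) := by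
  have hpos : ∀ i ∈ Finset.range (k + 1 : ℕ), (√(D i) : ℂ) ≠ 0 := fun i hi =>
    Complex.ofReal_ne_zero.2 (Real.sqrt_pos.2 (hk.trans_le
      (h.antitone (Nat.lt_succ_iff.1 (Finset.mem_range.1 hi))))).ne'
  have h1 : A * Q.submatrix id (Fin.castLE k.2 : Fin (k + 1) → Fin d) =
      (A * Q).submatrix id (Fin.castLE k.2 : Fin (k + 1) → Fin d) := by
    ext i j
    simp [Matrix.mul_apply]
  rw [singularMinor, h1, h.gram_submatrix, Matrix.det_diagonal,
    div_eq_iff (Finset.prod_ne_zero_iff.2 hpos), Complex.ofReal_prod,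
    ← Finset.prod_mul_distrib, Finset.prod_range]
  refine Finset.prod_congr rfl fun i _ => ?_
  rw [← Complex.ofReal_mul, Real.mul_self_sqrt (h.nonneg _)]

/-- The minors of `B` are dominated by products of singular values of `B`. -/
lemma IsSortedDiagonalization.norm_singularMinor_le (h : IsSortedDiagonalization A Q D) {k : Fin d}
    (hk : 0 < D k) {B Q' : Matrix (Fin d) (Fin d) ℂ} {D' : ℕ → ℝ}
    (h' : IsSortedDiagonalization B Q' D') :
    ‖singularMinor A Q D k B‖ ≤ ∏ i ∈ Finset.range (k + 1), √(D' i) := by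
  have hpos : 0 < ∏ i ∈ Finset.range (k + 1 : ℕ), √(D i) := Finset.prod_pos fun i hi =>
    Real.sqrt_pos.2 (hk.trans_le (h.antitone (Nat.lt_succ_iff.1 (Finset.mem_range.1 hi))))
  rw [singularMinor, norm_div, ← Complex.ofReal_prod, Complex.norm_real,
    Real.norm_of_nonneg hpos.le, div_le_iff₀ hpos]
  refine abs_le_of_sq_le_sq' ?_ (by positivity) |>.2
  refine (norm_det_mul_sq_le _ _).trans ?_
  set W := Q.submatrix id (Fin.castLE k.2 : Fin (k + 1) → Fin d) with hW
  have hQ : Q.conjTranspose * Q = 1 := mul_eq_one_comm.1 h.unitary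
  have hWW : W.conjTranspose * W = 1 := by
    rw [hW, Matrix.conjTranspose_submatrix, ← Matrix.submatrix_mul _ _ _ _ _ Function.bijective_id,
      hQ]
    exact Matrix.submatrix_one _ (Fin.castLE_injective _)
  have hB : B.conjTranspose * B =
      Q' * Matrix.diagonal (fun i : Fin d => (D' i : ℂ)) * Q'.conjTranspose := by
    rw [← h'.eq_diagonal]
    simp only [← Matrix.mul_assoc, h'.unitary, Matrix.one_mul]
    rw [Matrix.mul_assoc _ Q', h'.unitary, Matrix.mul_one]
  have h1 : (B * W).conjTranspose * (B * W) = (Q'.conjTranspose * W).conjTranspose *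
      Matrix.diagonal (fun i : Fin d => (D' i : ℂ)) * (Q'.conjTranspose * W) := by
    rw [Matrix.conjTranspose_mul, Matrix.mul_assoc, ← Matrix.mul_assoc _ B, hB,
      Matrix.conjTranspose_mul, Matrix.conjTranspose_conjTranspose]
    simp only [Matrix.mul_assoc]
  have h2 : (Q'.conjTranspose * W).conjTranspose * (Q'.conjTranspose * W) = 1 := by
    rw [Matrix.conjTranspose_mul, Matrix.conjTranspose_conjTranspose, Matrix.mul_assoc,
      ← Matrix.mul_assoc Q', h'.unitary, Matrix.one_mul, hWW]
  have h3 := norm_det_compression_diagonal_le h'.antitone h'.nonneg (Q'.conjTranspose * W)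
  rw [h2, Matrix.det_one, norm_one, mul_one] at h3
  rw [h1, h.gram_submatrix, Matrix.det_diagonal, ← Complex.ofReal_prod, Complex.norm_real,
    Real.norm_of_nonneg (Finset.prod_nonneg fun i _ => h.nonneg _), mul_pow, ← Finset.prod_pow,
    ← Finset.prod_pow, mul_comm]
  refine mul_le_mul (h3.trans_eq ?_) (le_of_eq ?_) (Finset.prod_nonneg fun i _ => h.nonneg _)
    (by positivity)
  · exact Finset.prod_congr rfl fun i _ => (Real.sq_sqrt (h'.nonneg i)).symm
  · rw [Finset.prod_range]
    exact Finset.prod_congr rfl fun i _ => (Real.sq_sqrt (h.nonneg i)).symm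

end

/-! ### The variational formula for Schatten norms -/

section

variable {d : ℕ}

/-- Gibbs' variational principle for Schatten norms, in terms of singular values: it covers
`q = ∞`, where `1 / q.toReal = 0`. -/
lemma IsSortedDiagonalization.gibbs_le_log_schattenNorm {B Q : Matrix (Fin d) (Fin d) ℂ}
    {D : ℕ → ℝ} (h : IsSortedDiagonalization B Q D) {w : ℕ → ℝ} (hw : ∀ i, 0 ≤ w i)
    (hw1 : ∑ i ∈ Finset.range d, w i = 1) (hws : ∀ i ∈ Finset.range d, 0 < w i → 0 < √(D i))
    {q : ℝ≥0∞} (hq : q ≠ 0) :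
    0 < schattenNorm q B ∧ ∑ i ∈ Finset.range d, w i * Real.log √(D i) +
      (-∑ i ∈ Finset.range d, w i * Real.log (w i)) * (1 / q.toReal) ≤
        Real.log (schattenNorm q B) := by
  obtain ⟨j, hj, hjw⟩ : ∃ j ∈ Finset.range d, 0 < w j := by
    by_contra! h
    have := Finset.sum_nonpos h
    rw [hw1] at this
    linarith
  have hjs := hws j hj hjw
  by_cases hq' : q = ∞
  · subst hq'
    have hpos : 0 < schattenNorm ∞ B := hjs.trans_le (h.sqrt_le j)
    refine ⟨hpos, ?_⟩
    rw [ENNReal.toReal_top, div_zero, mul_zero, add_zero]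
    calc ∑ i ∈ Finset.range d, w i * Real.log √(D i)
        ≤ ∑ i ∈ Finset.range d, w i * Real.log (schattenNorm ∞ B) := by
          refine Finset.sum_le_sum fun i hi => ?_
          rcases (hw i).eq_or_lt with h0 | h0
          · simp [← h0]
          · exact mul_le_mul_of_nonneg_left (Real.log_le_log (hws i hi h0) (h.sqrt_le i)) (hw i)
      _ = _ := by rw [← Finset.sum_mul, hw1, one_mul]
  · have hq0 := ENNReal.toReal_pos hq hq'
    have hS : 0 < ∑ i ∈ Finset.range d, √(D i) ^ q.toReal :=
      Finset.sum_pos' (fun i _ => by positivity) ⟨j, hj, Real.rpow_pos_of_pos hjs _⟩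
    rw [h.schattenNorm_eq q hq hq', Real.log_rpow hS]
    exact ⟨Real.rpow_pos_of_pos hS _, gibbs_le_log_sum_rpow (fun i _ => hw i) hw1
      (fun i _ => Real.sqrt_nonneg _) hws hq0⟩

/-- The logarithm of a Schatten norm of `A` is attained by a combination, with nonnegative
coefficients, of logarithms of holomorphic functions of `A`, up to an entropy term, and the same
combination bounds the logarithm of every Schatten norm from below, the entropy term
being scaled by `1 / q`. -/
lemma exists_log_schattenNorm_eq (A : Matrix (Fin d) (Fin d) ℂ) {p : ℝ≥0∞} (hp : p ≠ 0)
    (hp' : p ≠ ∞) (hA : schattenNorm p A ≠ 0) :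
    ∃ (c : Fin d → ℝ) (m : Fin d → Matrix (Fin d) (Fin d) ℂ → ℂ) (h : ℝ),
      (∀ k, 0 ≤ c k) ∧ (∀ k, Differentiable ℂ (m k)) ∧ (∀ k, m k A ≠ 0) ∧
      Real.log (schattenNorm p A) = ∑ k, c k * Real.log ‖m k A‖ + h * (1 / p.toReal) ∧
      ∀ B, (∀ k, m k B ≠ 0) → ∀ q : ℝ≥0∞, q ≠ 0 → 0 < schattenNorm q B ∧
        ∑ k, c k * Real.log ‖m k B‖ + h * (1 / q.toReal) ≤ Real.log (schattenNorm q B) := by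
  obtain ⟨Q, D, hD⟩ := exists_isSortedDiagonalization A
  have hr := ENNReal.toReal_pos hp hp'
  set r := p.toReal with hrdef
  set s : ℕ → ℝ := fun i => √(D i) with hs
  have hs0 : ∀ i, 0 ≤ s i := fun i => Real.sqrt_nonneg _
  have hnorm : schattenNorm p A = (∑ i ∈ Finset.range d, s i ^ r) ^ (1 / r) :=
    hD.schattenNorm_eq p hp hp'
  set Z := ∑ i ∈ Finset.range d, s i ^ r with hZ
  have hZpos : 0 < Z := by
    refine lt_of_le_of_ne (Finset.sum_nonneg fun i _ => Real.rpow_nonneg (hs0 i) r) fun h => ?_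
    rw [hnorm, ← h, Real.zero_rpow (by positivity)] at hA
    exact hA rfl
  -- The Gibbs weights of the singular values of `A`.
  set w : ℕ → ℝ := fun i => s i ^ r / Z with hw
  have hw0 : ∀ i, 0 ≤ w i := fun i => div_nonneg (Real.rpow_nonneg (hs0 i) r) hZpos.le
  have hw1 : ∑ i ∈ Finset.range d, w i = 1 := by
    rw [← Finset.sum_div, div_self hZpos.ne']
  have hwanti : Antitone w := fun i j hij => div_le_div_of_nonneg_right
    (Real.rpow_le_rpow (hs0 j) (Real.sqrt_le_sqrt (hD.antitone hij)) hr.le) hZpos.le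
  have hwzero : ∀ i, ¬0 < D i → w i = 0 := fun i hi => by
    have : s i = 0 := Real.sqrt_eq_zero'.2 (not_lt.1 hi)
    simp only [hw, this, Real.zero_rpow hr.ne', zero_div]
  have hwpos : ∀ i, 0 < w i → 0 < D i := fun i hi => by
    by_contra h
    exact hi.ne' (hwzero i h)
  have hwd : w d = 0 := hwzero d (by rw [hD.zero_of_le d le_rfl]; exact lt_irrefl 0)
  have hczero : ∀ i, ¬0 < D i → w i - w (i + 1) = 0 := fun i hi => by
    rw [hwzero i hi, hwzero (i + 1) fun h => hi (h.trans_le (hD.antitone i.le_succ)), sub_zero]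
  -- The minors of order larger than the rank of `A` do not contribute and are replaced by `1`.
  set m : Fin d → Matrix (Fin d) (Fin d) ℂ → ℂ :=
    fun k => if 0 < D k then singularMinor A Q D k else 1 with hm
  have hmpos : ∀ k : Fin d, 0 < D k → m k = singularMinor A Q D k := fun k hk => if_pos hk
  have habel : ∀ a : ℕ → ℝ, ∑ k : Fin d, (w k - w (k + 1)) * ∑ i ∈ Finset.range (k + 1), a i =
      ∑ i ∈ Finset.range d, w i * a i := fun a => by
    rw [← Finset.sum_range fun k => (w k - w (k + 1)) * ∑ i ∈ Finset.range (k + 1), a i,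
      sum_sub_succ_mul_sum, hwd, zero_mul, sub_zero]
  have hself : ∀ k : Fin d, 0 < D k → ‖m k A‖ = ∏ i ∈ Finset.range (k + 1), s i := fun k hk => by
    rw [hmpos k hk, hD.singularMinor_self hk, Complex.norm_real,
      Real.norm_of_nonneg (Finset.prod_nonneg fun i _ => hs0 i)]
  have hspos : ∀ k : Fin d, 0 < D k → ∀ i ∈ Finset.range (k + 1 : ℕ), 0 < s i := fun k hk i hi =>
    Real.sqrt_pos.2 (hk.trans_le (hD.antitone (Nat.lt_succ_iff.1 (Finset.mem_range.1 hi))))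
  refine ⟨fun k => w k - w (k + 1), m, -∑ i ∈ Finset.range d, w i * Real.log (w i),
    fun k => sub_nonneg.2 (hwanti (Nat.le_succ k)), fun k => ?_, fun k => ?_, ?_, ?_⟩
  · simp only [hm]
    split_ifs
    · exact differentiable_singularMinor A Q D k
    · exact differentiable_const _
  · by_cases hk : 0 < D k
    · exact norm_pos_iff.1 (by rw [hself k hk]; exact Finset.prod_pos (hspos k hk))
    · simp [hm, hk]
  · have h1 : ∑ k : Fin d, (w k - w (k + 1)) * Real.log ‖m k A‖ =
        ∑ i ∈ Finset.range d, w i * Real.log (s i) := by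
      rw [← habel]
      refine Finset.sum_congr rfl fun k _ => ?_
      by_cases hk : 0 < D k
      · rw [hself k hk, Real.log_prod fun i hi => (hspos k hk i hi).ne']
      · rw [hczero k hk, zero_mul, zero_mul]
    have h2 : ∀ i ∈ Finset.range d, w i * Real.log (s i) =
        1 / r * (w i * Real.log (w i)) + w i * (1 / r * Real.log Z) := fun i _ => by
      by_cases hi : 0 < D i
      · have hsi : 0 < s i := Real.sqrt_pos.2 hi
        have : Real.log (w i) = r * Real.log (s i) - Real.log Z := by
          rw [hw, Real.log_div (Real.rpow_pos_of_pos hsi r).ne' hZpos.ne', Real.log_rpow hsi]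
        rw [this]
        field_simp
        ring
      · rw [hwzero i hi]; ring
    rw [h1, Finset.sum_congr rfl h2, Finset.sum_add_distrib, ← Finset.mul_sum, ← Finset.sum_mul, hw1,
      hnorm, Real.log_rpow hZpos]
    ring
  · intro B hB q hq
    obtain ⟨Q', D', hD'⟩ := exists_isSortedDiagonalization B
    have hle : ∀ k : Fin d, 0 < D k → ‖m k B‖ ≤ ∏ i ∈ Finset.range (k + 1), √(D' i) :=
      fun k hk => by rw [hmpos k hk]; exact hD.norm_singularMinor_le hk hD'
    have hpos : ∀ k : Fin d, 0 < D k → ∀ i ∈ Finset.range (k + 1 : ℕ), 0 < √(D' i) :=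
      fun k hk i hi => by
        have h1 := (norm_pos_iff.2 (hB k)).trans_le (hle k hk)
        exact (Real.sqrt_nonneg _).lt_of_ne' (Finset.prod_ne_zero_iff.1 h1.ne' i hi)
    obtain ⟨h1, h2⟩ := hD'.gibbs_le_log_schattenNorm hw0 hw1 (fun i hi hwi =>
      hpos ⟨i, Finset.mem_range.1 hi⟩ (hwpos i hwi) i (Finset.self_mem_range_succ i)) hq
    refine ⟨h1, le_trans ?_ h2⟩
    rw [← habel fun i => Real.log √(D' i)]
    refine add_le_add (Finset.sum_le_sum fun k _ => ?_) le_rfl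
    beta_reduce
    by_cases hk : 0 < D k
    · refine mul_le_mul_of_nonneg_left ?_ (sub_nonneg.2 (hwanti (Nat.le_succ k)))
      rw [← Real.log_prod fun i hi => (hpos k hk i hi).ne']
      exact Real.log_le_log (norm_pos_iff.2 (hB k)) (hle k hk)
    · rw [hczero k hk, zero_mul, zero_mul]

end

/-! ### Interpolation of Schatten norms -/

lemma extIntegral_eq_coe_integral {f : ℝ → EReal} {l : ℝ → ℝ}
    (h : f =ᵐ[volume] fun t => (l t : EReal)) (hl : Integrable l) :
    extIntegral f = ((∫ t, l t : ℝ) : EReal) := by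
  have h1 : ∫⁻ t, (f t).toENNReal = ∫⁻ t, ENNReal.ofReal (l t) :=
    lintegral_congr_ae (h.mono fun t ht => by simp only [ht, EReal.real_coe_toENNReal])
  have h2 : ∫⁻ t, (-f t).toENNReal = ∫⁻ t, ENNReal.ofReal (-l t) :=
    lintegral_congr_ae (h.mono fun t ht => by
      simp only [ht, ← EReal.coe_neg, EReal.real_coe_toENNReal])
  have h3 : ∀ x : ℝ≥0∞, x ≠ ∞ → ((x.toReal : ℝ) : EReal) = (x : EReal) := fun x hx => by
    rw [← EReal.toReal_coe_ennreal, EReal.coe_toReal (by simpa using hx) (by simp)]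
  have h4 : ∫⁻ t, ENNReal.ofReal (-l t) ≠ ∞ := hl.neg.lintegral_lt_top.ne
  rw [extIntegral, h1, h2, integral_eq_lintegral_pos_part_sub_lintegral_neg_part hl, EReal.coe_sub,
    h3 _ hl.lintegral_lt_top.ne, h3 _ h4]

lemma coe_mul_extLog_rpow {K x a : ℝ} (hx : 0 < x) :
    (K : EReal) * extLog (x ^ a) = ((a * K * Real.log x : ℝ) : EReal) := by
  rw [extLog_of_pos (Real.rpow_pos_of_pos hx a), Real.log_rpow hx, ← EReal.coe_mul]
  congr 1
  ring

lemma coe_mul_extLog_rpow_le {K x a C : ℝ} (hK : 0 < K) (ha : 0 < a) (hx : 0 ≤ x) (hxC : x ≤ C) :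
    (K : EReal) * extLog (x ^ a) ≤ ((a * K * Real.log C : ℝ) : EReal) := by
  rcases hx.eq_or_lt with rfl | hx
  · rw [Real.zero_rpow ha.ne', extLog, ENNReal.ofReal_zero, ENNReal.log_zero,
      EReal.coe_mul_bot_of_pos hK]
    exact bot_le
  · rw [coe_mul_extLog_rpow hx, EReal.coe_le_coe_iff]
    exact mul_le_mul_of_nonneg_left (Real.log_le_log hx hxC) (by positivity)

section

variable {p₀ p₁ : ℝ≥0∞} {θ : ℝ}

lemma ofReal_div_ne_zero_and_ne_top (hp₀ : 0 < p₀) (hp : p₀ < p₁) (hθ₁ : θ < 1) :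
    ENNReal.ofReal (1 - θ) / p₀ ≠ 0 ∧ ENNReal.ofReal (1 - θ) / p₀ ≠ ∞ ∧
      ENNReal.ofReal θ / p₁ ≠ ∞ :=
  ⟨(ENNReal.div_pos (ENNReal.ofReal_pos.2 (sub_pos.2 hθ₁)).ne' hp.ne_top).ne',
    ENNReal.div_ne_top ENNReal.ofReal_ne_top hp₀.ne',
    ENNReal.div_ne_top ENNReal.ofReal_ne_top (hp₀.trans hp).ne'⟩

lemma interpExponent_ne_zero (hp₀ : 0 < p₀) (hp : p₀ < p₁) (hθ₁ : θ < 1) :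
    interpExponent p₀ p₁ θ ≠ 0 :=
  have h := ofReal_div_ne_zero_and_ne_top hp₀ hp hθ₁
  ENNReal.inv_ne_zero.2 (ENNReal.add_ne_top.2 ⟨h.2.1, h.2.2⟩)

lemma interpExponent_ne_top (hp₀ : 0 < p₀) (hp : p₀ < p₁) (hθ₁ : θ < 1) :
    interpExponent p₀ p₁ θ ≠ ∞ :=
  have h := ofReal_div_ne_zero_and_ne_top hp₀ hp hθ₁
  ENNReal.inv_ne_top.2 fun h' => h.1 (add_eq_zero.1 h').1

lemma one_div_toReal_interpExponent (hp₀ : 0 < p₀) (hp : p₀ < p₁) (hθ₀ : 0 < θ) (hθ₁ : θ < 1) :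
    1 / (interpExponent p₀ p₁ θ).toReal = (1 - θ) * (1 / p₀.toReal) + θ * (1 / p₁.toReal) := by
  have h := ofReal_div_ne_zero_and_ne_top hp₀ hp hθ₁
  rw [interpExponent, ENNReal.toReal_inv, one_div, inv_inv, ENNReal.toReal_add h.2.1 h.2.2,
    ENNReal.toReal_div, ENNReal.toReal_div, ENNReal.toReal_ofReal hθ₀.le,
    ENNReal.toReal_ofReal (sub_pos.2 hθ₁).le]
  ring

end

section

variable {d : ℕ}

lemma schattenNorm_nonneg {p : ℝ≥0∞} (hp : p ≠ 0) (A : Matrix (Fin d) (Fin d) ℂ) :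
    0 ≤ schattenNorm p A := by
  by_cases h : p = ∞
  · rw [schattenNorm, if_pos h]
    exact norm_nonneg _
  · obtain ⟨Q, D, hD⟩ := exists_isSortedDiagonalization A
    rw [hD.schattenNorm_eq p hp h]
    positivity

variable {G : ℂ → Matrix (Fin d) (Fin d) ℂ}

/-- Continuous functions of a bounded matrix-valued function on the strip are bounded. -/
lemma IsAF.exists_bound_comp (hG : IsAF G) {X : Type*} [NormedAddCommGroup X]
    {φ : Matrix (Fin d) (Fin d) ℂ → X} (hφ : Continuous φ) :
    ∃ C : ℝ, ∀ z : ℂ, 0 ≤ z.re → z.re ≤ 1 → ‖φ (G z)‖ ≤ C := by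
  obtain ⟨R, hR⟩ := hG.bounded
  have : ProperSpace (Matrix (Fin d) (Fin d) ℂ) := FiniteDimensional.proper ℂ _
  obtain ⟨C, hC⟩ := (isCompact_closedBall
    (0 : Matrix (Fin d) (Fin d) ℂ) R).exists_bound_of_continuousOn hφ.continuousOn
  exact ⟨C, fun z h h' => hC _ (by simpa using hR z h h')⟩

lemma IsAF.comp_differentiable (hG : IsAF G) {φ : Matrix (Fin d) (Fin d) ℂ → ℂ}
    (hφ : Differentiable ℂ φ) : IsAF fun z => φ (G z) :=
  ⟨hφ.comp_differentiableOn hG.analytic, hφ.continuous.comp_continuousOn hG.continuous,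
    hG.exists_bound_comp hφ.continuous⟩

end

theorem mainTheorem9 (d : ℕ) (G : ℂ → Matrix (Fin d) (Fin d) ℂ) (hG : IsAF G)
    (p₀ p₁ : ℝ≥0∞) (hp₀ : 0 < p₀) (hp : p₀ < p₁) (θ : ℝ) (hθ₀ : 0 < θ) (hθ₁ : θ < 1) :
    Measurable (hirschmanIntegrand G p₀ p₁ θ) ∧
    (∫⁻ t : ℝ, (hirschmanIntegrand G p₀ p₁ θ t).toENNReal) < ∞ ∧
    extLog (schattenNorm (interpExponent p₀ p₁ θ) (G θ)) ≤
      extIntegral (hirschmanIntegrand G p₀ p₁ θ) := by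
  have hε : (-1 : ℝ) ^ 2 = 1 := by norm_num
  have hp₁ : 0 < p₁ := hp₀.trans hp
  have h1θ : 0 < 1 - θ := sub_pos.2 hθ₁
  have hN₀ : Continuous fun t : ℝ => schattenNorm p₀ (G (Complex.I * t)) :=
    (continuous_schattenNorm hp₀.ne').comp hG.continuous_left
  have hN₁ : Continuous fun t : ℝ => schattenNorm p₁ (G (1 + Complex.I * t)) :=
    (continuous_schattenNorm hp₁.ne').comp hG.continuous_right
  have hk₀ := stripDensity_pos hθ₀ hθ₁ (one_pow 2)
  have hk₁ := stripDensity_pos hθ₀ hθ₁ hε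
  have hkc₀ := continuous_stripDensity hθ₀ hθ₁ (one_pow 2)
  have hkc₁ := continuous_stripDensity hθ₀ hθ₁ hε
  have hki₀ := integrable_stripDensity hθ₀ hθ₁ (one_pow 2)
  have hki₁ := integrable_stripDensity hθ₀ hθ₁ hε
  have hK₀ : ∀ t, hirschmanKernel (1 - θ) t = (1 - θ)⁻¹ * stripDensity θ 1 t := fun t => by
    rw [← hirschmanKernel_one_sub_mul hθ₁, inv_mul_cancel_left₀ h1θ.ne']
  have hK₁ : ∀ t, hirschmanKernel θ t = θ⁻¹ * stripDensity θ (-1) t := fun t => by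
    rw [← hirschmanKernel_mul hθ₀, inv_mul_cancel_left₀ hθ₀.ne']
  have hKpos₀ : ∀ t, 0 < hirschmanKernel (1 - θ) t := fun t => by
    rw [hK₀]; exact mul_pos (inv_pos.2 h1θ) (hk₀ t)
  have hKpos₁ : ∀ t, 0 < hirschmanKernel θ t := fun t => by
    rw [hK₁]; exact mul_pos (inv_pos.2 hθ₀) (hk₁ t)
  obtain ⟨C₀, hC₀⟩ := hG.exists_bound_comp (continuous_schattenNorm hp₀.ne')
  obtain ⟨C₁, hC₁⟩ := hG.exists_bound_comp (continuous_schattenNorm hp₁.ne')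
  have hC₀' : ∀ t : ℝ, schattenNorm p₀ (G (Complex.I * t)) ≤ C₀ := fun t =>
    (le_abs_self _).trans (hC₀ _ (by simp) (by simp))
  have hC₁' : ∀ t : ℝ, schattenNorm p₁ (G (1 + Complex.I * t)) ≤ C₁ := fun t =>
    (le_abs_self _).trans (hC₁ _ (by simp) (by simp))
  have hmeas : Measurable (hirschmanIntegrand G p₀ p₁ θ) := by
    have h₀ : Measurable fun t => hirschmanKernel (1 - θ) t := by
      simp only [hK₀]; exact hkc₀.measurable.const_mul _
    have h₁ : Measurable fun t => hirschmanKernel θ t := by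
      simp only [hK₁]; exact hkc₁.measurable.const_mul _
    unfold hirschmanIntegrand
    exact (h₀.coe_real_ereal.mul (continuous_extLog.measurable.comp (hN₀.measurable.pow_const _))).add
      (h₁.coe_real_ereal.mul (continuous_extLog.measurable.comp (hN₁.measurable.pow_const _)))
  refine ⟨hmeas, ?_, ?_⟩
  · refine lt_of_le_of_lt (lintegral_mono fun t => ?_)
      ((hki₀.mul_const (Real.log C₀)).add (hki₁.mul_const (Real.log C₁))).lintegral_lt_top
    rw [← EReal.real_coe_toENNReal]
    refine EReal.toENNReal_le_toENNReal ?_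
    rw [Pi.add_apply, EReal.coe_add, ← hirschmanKernel_one_sub_mul hθ₁, ← hirschmanKernel_mul hθ₀]
    exact add_le_add
      (coe_mul_extLog_rpow_le (hKpos₀ t) h1θ (schattenNorm_nonneg hp₀.ne' _) (hC₀' t))
      (coe_mul_extLog_rpow_le (hKpos₁ t) hθ₀ (schattenNorm_nonneg hp₁.ne' _) (hC₁' t))
  have hpθ := interpExponent_ne_zero hp₀ hp hθ₁
  -- If `G θ = 0`, then the left-hand side is `-∞`.
  rcases (schattenNorm_nonneg hpθ (G θ)).eq_or_lt with h0 | hpos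
  · rw [← h0, extLog, ENNReal.ofReal_zero, ENNReal.log_zero]
    exact bot_le
  obtain ⟨c, m, h, hc, hm, hmθ, heq, hle⟩ := exists_log_schattenNorm_eq (G θ) hpθ
    (interpExponent_ne_top hp₀ hp hθ₁) hpos.ne'
  have key := fun k => log_norm_le_integral_strip (hG.comp_differentiable (hm k)) hθ₀ hθ₁ (hmθ k)
  have hae₀ : ∀ᵐ t : ℝ, ∀ k, m k (G (Complex.I * t)) ≠ 0 := ae_all_iff.2 fun k => (key k).1
  have hae₁ : ∀ᵐ t : ℝ, ∀ k, m k (G (1 + Complex.I * t)) ≠ 0 := ae_all_iff.2 fun k => (key k).2.1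
  -- Integrable lower bounds of `log ‖G‖`, times the density, on the two boundary lines.
  let L₀ : ℝ → ℝ := fun t => ∑ k, c k * (stripDensity θ 1 t * Real.log ‖m k (G (Complex.I * t))‖) +
    stripDensity θ 1 t * (h * (1 / p₀.toReal))
  let L₁ : ℝ → ℝ := fun t =>
    ∑ k, c k * (stripDensity θ (-1) t * Real.log ‖m k (G (1 + Complex.I * t))‖) +
      stripDensity θ (-1) t * (h * (1 / p₁.toReal))
  have hS₀ : Integrable fun t : ℝ =>
      ∑ k, c k * (stripDensity θ 1 t * Real.log ‖m k (G (Complex.I * t))‖) :=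
    integrable_finsetSum _ fun k _ => (key k).2.2.1.const_mul _
  have hS₁ : Integrable fun t : ℝ =>
      ∑ k, c k * (stripDensity θ (-1) t * Real.log ‖m k (G (1 + Complex.I * t))‖) :=
    integrable_finsetSum _ fun k _ => (key k).2.2.2.1.const_mul _
  have hL₀ : Integrable L₀ := hS₀.add (hki₀.mul_const _)
  have hL₁ : Integrable L₁ := hS₁.add (hki₁.mul_const _)
  have hlow₀ : ∀ᵐ t : ℝ, 0 < schattenNorm p₀ (G (Complex.I * t)) ∧
      L₀ t ≤ stripDensity θ 1 t * Real.log (schattenNorm p₀ (G (Complex.I * t))) := by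
    filter_upwards [hae₀] with t ht
    obtain ⟨h1, h2⟩ := hle _ ht p₀ hp₀.ne'
    refine ⟨h1, le_of_eq_of_le ?_ (mul_le_mul_of_nonneg_left h2 (hk₀ t).le)⟩
    simp only [L₀]
    rw [mul_add, Finset.mul_sum]
    simp only [mul_left_comm]
  have hlow₁ : ∀ᵐ t : ℝ, 0 < schattenNorm p₁ (G (1 + Complex.I * t)) ∧
      L₁ t ≤ stripDensity θ (-1) t * Real.log (schattenNorm p₁ (G (1 + Complex.I * t))) := by
    filter_upwards [hae₁] with t ht
    obtain ⟨h1, h2⟩ := hle _ ht p₁ hp₁.ne'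
    refine ⟨h1, le_of_eq_of_le ?_ (mul_le_mul_of_nonneg_left h2 (hk₁ t).le)⟩
    simp only [L₁]
    rw [mul_add, Finset.mul_sum]
    simp only [mul_left_comm]
  have hint₀ : Integrable fun t : ℝ =>
      stripDensity θ 1 t * Real.log (schattenNorm p₀ (G (Complex.I * t))) := by
    refine integrable_of_le_of_le (hkc₀.measurable.mul hN₀.measurable.log).aestronglyMeasurable
      (hlow₀.mono fun t ht => ht.2) (hlow₀.mono fun t ht => ?_) hL₀ (hki₀.mul_const (Real.log C₀))
    exact mul_le_mul_of_nonneg_left (Real.log_le_log ht.1 (hC₀' t)) (hk₀ t).le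
  have hint₁ : Integrable fun t : ℝ =>
      stripDensity θ (-1) t * Real.log (schattenNorm p₁ (G (1 + Complex.I * t))) := by
    refine integrable_of_le_of_le (hkc₁.measurable.mul hN₁.measurable.log).aestronglyMeasurable
      (hlow₁.mono fun t ht => ht.2) (hlow₁.mono fun t ht => ?_) hL₁ (hki₁.mul_const (Real.log C₁))
    exact mul_le_mul_of_nonneg_left (Real.log_le_log ht.1 (hC₁' t)) (hk₁ t).le
  have hcoe : hirschmanIntegrand G p₀ p₁ θ =ᵐ[volume] fun t =>
      ((stripDensity θ 1 t * Real.log (schattenNorm p₀ (G (Complex.I * t))) +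
        stripDensity θ (-1) t * Real.log (schattenNorm p₁ (G (1 + Complex.I * t))) : ℝ) : EReal) := by
    filter_upwards [hlow₀, hlow₁] with t h₀ h₁
    rw [hirschmanIntegrand, coe_mul_extLog_rpow h₀.1, coe_mul_extLog_rpow h₁.1,
      hirschmanKernel_one_sub_mul hθ₁, hirschmanKernel_mul hθ₀, ← EReal.coe_add]
  rw [extIntegral_eq_coe_integral hcoe (hint₀.add hint₁), extLog_of_pos hpos, EReal.coe_le_coe_iff,
    integral_add hint₀ hint₁]
  have hI₀ : ∫ t, L₀ t = ∑ k, c k * (∫ t : ℝ, stripDensity θ 1 t *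
      Real.log ‖m k (G (Complex.I * t))‖) + (1 - θ) * (h * (1 / p₀.toReal)) := by
    rw [integral_add hS₀ (hki₀.mul_const _), integral_mul_const, integral_stripDensity_one hθ₀ hθ₁,
      integral_finsetSum _ fun k _ => (key k).2.2.1.const_mul _]
    simp only [integral_const_mul]
  have hI₁ : ∫ t, L₁ t = ∑ k, c k * (∫ t : ℝ, stripDensity θ (-1) t *
      Real.log ‖m k (G (1 + Complex.I * t))‖) + θ * (h * (1 / p₁.toReal)) := by
    rw [integral_add hS₁ (hki₁.mul_const _), integral_mul_const,
      integral_stripDensity_neg_one hθ₀ hθ₁,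
      integral_finsetSum _ fun k _ => (key k).2.2.2.1.const_mul _]
    simp only [integral_const_mul]
  have hsum : ∑ k, c k * Real.log ‖m k (G θ)‖ ≤
      ∑ k, c k * ((∫ t : ℝ, stripDensity θ 1 t * Real.log ‖m k (G (Complex.I * t))‖) +
        ∫ t : ℝ, stripDensity θ (-1) t * Real.log ‖m k (G (1 + Complex.I * t))‖) :=
    Finset.sum_le_sum fun k _ => mul_le_mul_of_nonneg_left (key k).2.2.2.2 (hc k)
  simp only [mul_add, Finset.sum_add_distrib] at hsum
  have hm₀ := integral_mono_ae hL₀ hint₀ (hlow₀.mono fun t ht => ht.2)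
  have hm₁ := integral_mono_ae hL₁ hint₁ (hlow₁.mono fun t ht => ht.2)
  rw [heq, one_div_toReal_interpExponent hp₀ hp hθ₀ hθ₁]
  linarith
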